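/- Let $\mathbb{B}^2=\{z\in\mathbb{C}^2 : |z|^2=|z_1|^2+|z_2|^2<1\}$, and let $\mathrm{SU}((2,1),\mathbb{C})=\{A\in \mathrm{SL}(3,\mathbb{C}) : A^*HA=H\}$, $H=\mathrm{diag}(1,1,-1)$, act on $\mathbb{B}^2$ by fractional linear transformations $\gamma z=(Az+B)/(Cz+D)$. Let $\Gamma\subset\mathrm{SU}((2,1),\mathbb{C})$ be a discrete, torsion-free subgroup such that $X_\Gamma=\Gamma\backslash\mathbb{B}^2$ is compact, and let $\mathcal{F}_\Gamma\subset\mathbb{B}^2$ be a fundamental domain for $\Gamma$. Let $$\mu^{\mathrm{vol}}_{\mathrm{hyp}}(z)=\Big(\frac{i}{2}\Big)^2\frac{dz_1\wedge d\bar z_1\wedge dz_2\wedge d\bar z_2}{(1-|z|^2)^3}$$ be the hyperbolic volume form. For $k\ge 1$ let $\Lambda=\Omega^2_{X_\Gamma}$ and let $H^0(X_\Gamma,\Lambda^{\otimes k})$ be the space of $\Gamma$-invariant holomorphic forms $\omega=f\,(dz_1\wedge dz_2)^{\otimes k}$ on $\mathbb{B}^2$, with the point-wise norm $|\omega(z)|^2_{\mathrm{hyp}}=(1-|z|^2)^{3k}|f(z)|^2$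 and the inner product $\langle \omega,\eta\rangle_{\mathrm{hyp}}=\int_{\mathcal{F}_\Gamma}(1-|z|^2)^{3k}f(z)\overline{g(z)}\,\mu^{\mathrm{vol}}_{\mathrm{hyp}}(z)$ for $\eta=g\,(dz_1\wedge dz_2)^{\otimes k}$. This space has a finite orthonormal basis. For an orthonormal basis $\omega_j=f_j\,(dz_1\wedge dz_2)^{\otimes k}$, $1\le j\le d_k$, let $$\big|\mathcal{B}^k_{\Lambda}(z,z)\big|_{\mathrm{hyp}}=(1-|z|^2)^{3k}\sum_{j=1}^{d_k}|f_j(z)|^2$$ be the norm of the Bergman kernel on the diagonal, let $\mu_{\mathrm{ber}}(z)=-\frac{i}{2\pi}\partial\bar\partial\log|\mathcal{B}^k_{\Lambda}(z,z)|_{\mathrm{hyp}}$ be the Bergman metric associated to $\Lambda^{\otimes k}$, and let $\mu^{\mathrm{vol}}_{\mathrm{ber}}=\frac{1}{2!}\,\mu_{\mathrm{ber}}\wedge\mu_{\mathrm{ber}}$ (both depend on $k$). Then, for every choice of orthonormal bases and for each $z\in\mathcal{F}_\Gamma$: for all sufficiently large $k$ (depending on $z$) the Bergman kernel does not vanish at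 $(z,z)$, so that $\mu_{\mathrm{ber}}$ is defined near $z$; the following limit exists; and $$\lim_{k\to\infty}\frac{1}{k^4\log k}\left|\frac{\mu^{\mathrm{vol}}_{\mathrm{ber}}(z)}{\mu^{\mathrm{vol}}_{\mathrm{hyp}}(z)}\right|\le 6048 .$$ -/

import Mathlib

open MeasureTheory Filter Topology Matrix

noncomputable section

namespace Picard

/-- The complex Euclidean plane `ℂ²`. -/
abbrev E : Type := EuclideanSpace ℂ (Fin 2)

/-- The unit ball `𝔹² = {z ∈ ℂ² | |z₁|² + |z₂|² < 1}`. -/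
abbrev Ball2 : Type := ↥(Metric.ball (0 : E) 1)

/-- The Hermitian matrix `H = diag(1, 1, -1)` of signature `(2, 1)`. -/
def H : Matrix (Fin 3) (Fin 3) ℂ := Matrix.diagonal ![1, 1, -1]

lemma unitary_mul {A B : Matrix (Fin 3) (Fin 3) ℂ} (hA : Aᴴ * H * A = H) (hB : Bᴴ * H * B = H) :
    (A * B)ᴴ * H * (A * B) = H := by
  calc (A * B)ᴴ * H * (A * B) = Bᴴ * (Aᴴ * H * A) * B := by
        rw [conjTranspose_mul]; simp only [Matrix.mul_assoc]
    _ = H := by rw [hA, hB]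

lemma unitary_inv {A B : Matrix (Fin 3) (Fin 3) ℂ} (hA : Aᴴ * H * A = H) (h : A * B = 1) :
    Bᴴ * H * B = H := by
  have h' : Bᴴ * Aᴴ = 1 := by rw [← conjTranspose_mul, h, conjTranspose_one]
  calc Bᴴ * H * B = Bᴴ * (Aᴴ * H * A) * B := by rw [hA]
    _ = (Bᴴ * Aᴴ) * H * (A * B) := by simp only [Matrix.mul_assoc]
    _ = H := by rw [h, h', Matrix.one_mul, Matrix.mul_one]

/-- `SU((2,1), ℂ) = {A ∈ SL(3, ℂ) | A* H A = H}`. -/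
def SU21 : Subgroup (Matrix.SpecialLinearGroup (Fin 3) ℂ) where
  carrier := {A | (A : Matrix (Fin 3) (Fin 3) ℂ)ᴴ * H * (A : Matrix (Fin 3) (Fin 3) ℂ) = H}
  one_mem' := by simp
  mul_mem' := fun hA hB => unitary_mul hA hB
  inv_mem' := fun {A} hA => unitary_inv hA (congrArg Subtype.val (mul_inv_cancel A))

/-- The matrix of an element of `SU((2,1), ℂ)`. -/
def mat (g : SU21) : Matrix (Fin 3) (Fin 3) ℂ := (g : Matrix.SpecialLinearGroup (Fin 3) ℂ)

/-- The lift `(z₁, z₂, 1)` of a point of `ℂ²` to `ℂ³`. -/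
def lift (z : E) : Fin 3 → ℂ := ![z 0, z 1, 1]

/-- The fractional linear transformation `z ↦ (Az + B)/(Cz + D)` of a `3 × 3` matrix in block
form `(A, B; C, D)`: apply the matrix to the lift of `z` and divide by the last coordinate. -/
def moebius (g : Matrix (Fin 3) (Fin 3) ℂ) (z : E) : E :=
  !₂[(g *ᵥ lift z) 0 / (g *ᵥ lift z) 2, (g *ᵥ lift z) 1 / (g *ᵥ lift z) 2]

lemma mem_ball_iff (z : E) :
    z ∈ Metric.ball (0 : E) 1 ↔ ‖z 0‖ ^ 2 + ‖z 1‖ ^ 2 < 1 := by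
  rw [mem_ball_zero_iff, EuclideanSpace.norm_eq, Real.sqrt_lt' one_pos]
  simp

lemma hermForm_eq (v : Fin 3 → ℂ) :
    star v ⬝ᵥ (H *ᵥ v) = ((‖v 0‖ ^ 2 + ‖v 1‖ ^ 2 - ‖v 2‖ ^ 2 : ℝ) : ℂ) := by
  have h (x : ℂ) : (starRingEnd ℂ) x * x = ((‖x‖ ^ 2 : ℝ) : ℂ) := by
    rw [mul_comm, Complex.mul_conj, Complex.normSq_eq_norm_sq]
  simp only [dotProduct, H, mulVec_diagonal, Fin.sum_univ_three, Pi.star_apply,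
    Complex.ofReal_sub, Complex.ofReal_add, ← h]
  simp
  ring

lemma hermForm_mulVec (g : SU21) (v : Fin 3 → ℂ) :
    star (mat g *ᵥ v) ⬝ᵥ (H *ᵥ (mat g *ᵥ v)) = star v ⬝ᵥ (H *ᵥ v) := by
  have hg : ((mat g))ᴴ * H * (mat g) = H := g.2
  rw [star_mulVec, ← dotProduct_mulVec, mulVec_mulVec, mulVec_mulVec, hg]

lemma norm_mulVec_lift (g : SU21) (z : E) :
    ‖(mat g *ᵥ lift z) 0‖ ^ 2 + ‖(mat g *ᵥ lift z) 1‖ ^ 2 - ‖(mat g *ᵥ lift z) 2‖ ^ 2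
      = ‖z 0‖ ^ 2 + ‖z 1‖ ^ 2 - 1 := by
  have h := hermForm_mulVec g (lift z)
  rw [hermForm_eq, hermForm_eq] at h
  have h2 := Complex.ofReal_injective h
  simpa [lift] using h2

lemma denom_ne_zero (g : SU21) (z : Ball2) : (mat g *ᵥ lift z.1) 2 ≠ 0 := by
  intro h0
  have h := norm_mulVec_lift g z.1
  have hz := (mem_ball_iff z.1).1 z.2
  rw [h0] at h
  have h1 := sq_nonneg ‖(mat g *ᵥ lift z.1) 0‖
  have h2 := sq_nonneg ‖(mat g *ᵥ lift z.1) 1‖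
  simp only [norm_zero] at h
  linarith

lemma moebius_mem_ball (g : SU21) (z : Ball2) :
    moebius (mat g) z.1 ∈ Metric.ball (0 : E) 1 := by
  rw [mem_ball_iff]
  have h := norm_mulVec_lift g z.1
  have hz := (mem_ball_iff z.1).1 z.2
  have hpos : 0 < ‖(mat g *ᵥ lift z.1) 2‖ ^ 2 :=
    pow_pos (norm_pos_iff.2 (denom_ne_zero g z)) 2
  simp only [moebius, PiLp.toLp_apply, Matrix.cons_val_zero, Matrix.cons_val_one, norm_div, div_pow]
  rw [← add_div, div_lt_one hpos]
  linarith

lemma lift_moebius (g : SU21) (z : Ball2) :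
    lift (moebius (mat g) z.1) = ((mat g *ᵥ lift z.1) 2)⁻¹ • (mat g *ᵥ lift z.1) := by
  have h := denom_ne_zero g z
  ext i
  fin_cases i
  · simp [lift, moebius, div_eq_inv_mul]
  · simp [lift, moebius, div_eq_inv_mul]
  · simpa [lift, moebius] using (inv_mul_cancel₀ h).symm

lemma mat_mul (g h : SU21) : mat (g * h) = mat g * mat h := by
  simp [mat]

/-- The action of `SU((2,1), ℂ)` on the ball by fractional linear transformations. -/
instance : MulAction SU21 Ball2 where
  smul g z := ⟨moebius (mat g) z.1, moebius_mem_ball g z⟩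
  one_smul z := by
    apply Subtype.ext
    change moebius (mat 1) z.1 = z.1
    ext i
    fin_cases i <;> simp [moebius, lift, mat]
  mul_smul g h z := by
    apply Subtype.ext
    change moebius ((mat (g * h))) z.1 = moebius (mat g) (moebius (mat h) z.1)
    have h1 : (mat (g * h)) *ᵥ lift z.1 = (mat g) *ᵥ (mat h *ᵥ lift z.1) := by
      rw [mulVec_mulVec, mat_mul]
    have h2 := inv_ne_zero (denom_ne_zero h z)
    have h3 : (mat g) *ᵥ lift (moebius (mat h) z.1)
        = ((mat h *ᵥ lift z.1) 2)⁻¹ • ((mat (g * h)) *ᵥ lift z.1) := by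
      rw [lift_moebius, mulVec_smul, h1]
    rw [moebius, moebius.eq_1 (mat g), h3]
    simp only [Pi.smul_apply, smul_eq_mul, mul_div_mul_left _ _ h2]

/-- The quotient `X_Γ = Γ \ 𝔹²`, with the quotient topology. -/
abbrev PicardSurface (Γ : Subgroup SU21) : Type := MulAction.orbitRel.Quotient Γ Ball2

/-- The measure on `𝔹²` given by the hyperbolic volume form
`(i/2)² dz₁ ∧ dz̄₁ ∧ dz₂ ∧ dz̄₂ / (1 - |z|²)³`; here `(i/2)² dz₁ ∧ dz̄₁ ∧ dz₂ ∧ dz̄₂` is Lebesgue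
measure on `ℂ²`. -/
def hypMeasure : Measure Ball2 :=
  (Measure.comap (Subtype.val : Ball2 → E) volume).withDensity
    (fun z => ENNReal.ofReal (((1 - ‖z.1‖ ^ 2) ^ 3)⁻¹))

/-- A function on the ball, extended by zero to `ℂ²`. -/
def extendZero (f : Ball2 → ℂ) : E → ℂ := Function.extend Subtype.val f 0

lemma extendZero_apply (f : Ball2 → ℂ) {x : E} (hx : x ∈ Metric.ball (0 : E) 1) :
    extendZero f x = f ⟨x, hx⟩ :=
  Subtype.val_injective.extend_apply f 0 (⟨x, hx⟩ : Ball2)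

/-- A function on the (open) ball is holomorphic. -/
def IsHolomorphic (f : Ball2 → ℂ) : Prop :=
  DifferentiableOn ℂ (extendZero f) (Metric.ball (0 : E) 1)

/-- The complex Jacobian determinant of the action of `γ` on the ball, that is, the function `j`
with `γ^*(dz₁ ∧ dz₂) = j dz₁ ∧ dz₂`. -/
def jacobian (γ : SU21) (z : Ball2) : ℂ := (fderiv ℂ (moebius (mat γ)) z.1).det

/-- `H⁰(X_Γ, Λ^{⊗k})` for `Λ = Ω²_{X_Γ}`: holomorphic sections of `Λ^{⊗k}` are the holomorphic
sections `f (dz₁ ∧ dz₂)^{⊗k}` over the ball which are invariant under pull-back by every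
`γ ∈ Γ`. The section is represented by its coefficient `f`. -/
def H0 (Γ : Subgroup SU21) (k : ℕ) : Submodule ℂ (Ball2 → ℂ) where
  carrier := {f | IsHolomorphic f ∧ ∀ γ ∈ Γ, ∀ z : Ball2, f (γ • z) * jacobian γ z ^ k = f z}
  zero_mem' := by
    refine ⟨?_, fun γ _ z => by simp⟩
    refine (differentiableOn_const (0 : ℂ)).congr (fun x hx => ?_)
    rw [extendZero_apply _ hx]; rfl
  add_mem' := by
    rintro f g ⟨hf, hf'⟩ ⟨hg, hg'⟩
    refine ⟨?_, fun γ hγ z => ?_⟩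
    · refine (DifferentiableOn.add hf hg).congr (fun x hx => ?_)
      simp only [Pi.add_apply, extendZero_apply _ hx]
    · rw [Pi.add_apply, Pi.add_apply, add_mul, hf' γ hγ z, hg' γ hγ z]
  smul_mem' := by
    rintro c f ⟨hf, hf'⟩
    refine ⟨?_, fun γ hγ z => ?_⟩
    · refine (DifferentiableOn.const_smul hf c).congr (fun x hx => ?_)
      simp only [Pi.smul_apply, extendZero_apply _ hx]
    · rw [Pi.smul_apply, Pi.smul_apply, smul_mul_assoc, hf' γ hγ z]

/-- The `L²` inner product on `H⁰(X_Γ, Λ^{⊗k})` induced by the hyperbolic metric, for which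
`|dz₁ ∧ dz₂|² = (1 - |z|²)³`, as an integral over a fundamental domain `F`. -/
def innerHyp (F : Set Ball2) (k : ℕ) (f g : Ball2 → ℂ) : ℂ :=
  ∫ z in F, (((1 - ‖z.1‖ ^ 2) ^ (3 * k) : ℝ) : ℂ) * f z * starRingEnd ℂ (g z) ∂hypMeasure

/-- `ω₁, …, ω_d` is an orthonormal basis of `H⁰(X_Γ, Λ^{⊗k})`. -/
def IsOrthonormalBasis (Γ : Subgroup SU21) (F : Set Ball2) (k : ℕ) {d : ℕ}
    (ω : Fin d → H0 Γ k) : Prop :=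
  (∀ i j, innerHyp F k (ω i) (ω j) = if i = j then 1 else 0) ∧
    Submodule.span ℂ (Set.range ω) = ⊤

/-- The Bergman kernel `∑ⱼ ωⱼ(z) conj(ωⱼ(w))` of a basis of `H⁰(X_Γ, Λ^{⊗k})`, in the frames
`(dz₁ ∧ dz₂)^{⊗k}` and `conj (dw₁ ∧ dw₂)^{⊗k}`. -/
def bergmanKernel {Γ : Subgroup SU21} {k d : ℕ} (ω : Fin d → H0 Γ k) (z w : Ball2) : ℂ :=
  ∑ j, (ω j : Ball2 → ℂ) z * starRingEnd ℂ ((ω j : Ball2 → ℂ) w)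

/-- The hyperbolic norm `|B(z, z)|_hyp = (1 - |z|²)^{3k} |B(z, z)|` of the Bergman kernel on the
diagonal. -/
def bergmanNorm {Γ : Subgroup SU21} {k d : ℕ} (ω : Fin d → H0 Γ k) (z : Ball2) : ℝ :=
  (1 - ‖z.1‖ ^ 2) ^ (3 * k) * ‖bergmanKernel ω z z‖

/-- The `j`-th standard basis vector of `ℂ²`. -/
def e (j : Fin 2) : E := EuclideanSpace.single j 1

/-- The Wirtinger derivative `∂φ/∂z_j = ½ (∂φ/∂x_j - i ∂φ/∂y_j)`. -/
def dZ (j : Fin 2) (φ : E → ℂ) (z : E) : ℂ :=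
  (1 / 2) * (fderiv ℝ φ z (e j) - Complex.I * fderiv ℝ φ z (Complex.I • e j))

/-- The Wirtinger derivative `∂φ/∂z̄_j = ½ (∂φ/∂x_j + i ∂φ/∂y_j)`. -/
def dZbar (j : Fin 2) (φ : E → ℂ) (z : E) : ℂ :=
  (1 / 2) * (fderiv ℝ φ z (e j) + Complex.I * fderiv ℝ φ z (Complex.I • e j))

/-- The form `∂∂̄φ = ∑_{j,l} ∂²φ/∂z_j∂z̄_l dz_j ∧ dz̄_l` at the point `z`, as an alternating function
of two tangent vectors. -/
def ddbar (φ : E → ℂ) (z : E) (u v : E) : ℂ :=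
  ∑ j : Fin 2, ∑ l : Fin 2,
    dZ j (dZbar l φ) z * (u j * starRingEnd ℂ (v l) - v j * starRingEnd ℂ (u l))

/-- For a `2`-form `α` on `ℂ² = ℝ⁴`, the `4`-form `(1/2!) α ∧ α`. -/
def halfWedgeSq (α : E → E → ℂ) (v : Fin 4 → E) : ℂ :=
  α (v 0) (v 1) * α (v 2) (v 3) - α (v 0) (v 2) * α (v 1) (v 3) + α (v 0) (v 3) * α (v 1) (v 2)

/-- The Bergman metric `-(i/2π) ∂∂̄ log |B(z, z)|_hyp` at the point `z`, as a `(1,1)`-form. -/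
def bergmanMetric {Γ : Subgroup SU21} {k d : ℕ} (ω : Fin d → H0 Γ k) (z : Ball2) (u v : E) : ℂ :=
  -(Complex.I / (2 * Real.pi)) *
    ddbar (extendZero fun x => (Real.log (bergmanNorm ω x) : ℂ)) z.1 u v

/-- The volume form of the Bergman metric at `z`. -/
def bergmanVol {Γ : Subgroup SU21} {k d : ℕ} (ω : Fin d → H0 Γ k) (z : Ball2) :
    (Fin 4 → E) → ℂ :=
  halfWedgeSq (bergmanMetric ω z)

/-- The hyperbolic volume form `(i/2)² dz₁ ∧ dz̄₁ ∧ dz₂ ∧ dz̄₂ / (1 - |z|²)³` at `z`; the wedge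
product of the four `1`-forms is the determinant of their values. -/
def hypVol (z : Ball2) (v : Fin 4 → E) : ℂ :=
  (Complex.I / 2) ^ 2 *
    (Matrix.of fun a b : Fin 4 =>
      ![v b 0, starRingEnd ℂ (v b 0), v b 1, starRingEnd ℂ (v b 1)] a).det /
    (1 - ‖z.1‖ ^ 2 : ℝ) ^ 3

/-- The real frame `e₁, i e₁, e₂, i e₂` of `ℂ²`. -/
def frame : Fin 4 → E := ![e 0, Complex.I • e 0, e 1, Complex.I • e 1]

/-- The function `μ^vol_ber / μ^vol_hyp`: as the space of alternating `4`-forms on `ℝ⁴` is a line,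
the quotient of two `4`-forms is the quotient of their values on a frame. -/
def volRatio {Γ : Subgroup SU21} {k d : ℕ} (ω : Fin d → H0 Γ k) (z : Ball2) : ℂ :=
  bergmanVol ω z frame / hypVol z frame

end Picard

end

/-!
Unfolding the Poincaré series `∑ γ, f (γ z) j_γ(z)ᵏ` against an automorphic form shows that, up to
the factor `∫ (1 - |z|²)³ᵏ dμ_hyp`, the norm of the Bergman kernel at `g • 0` is the sum of
`j_{g⁻¹γg}(0)ᵏ` over `γ ∈ Γ`. Each `|j_{g⁻¹γg}(0)|` is at most `1`, with equality only if `γ` fixes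
`g • 0`, and the sum of their squares converges locally uniformly because an orbit of `Γ` meets a
compact set boundedly often. Hence the normalised kernel is bounded uniformly in `k` on compact
sets, and tends to `1` at points with trivial stabiliser.

Near such a point the logarithm of the norm of the Bergman kernel is `3k log (1 - |z|²)` plus the
logarithm of the squared norm of the holomorphic map `z ↦ (f₁(z), …, f_d(z))`. A Cauchy estimate on
a ball of radius comparable to `1/k`, on which `(1 - |z|²)³ᵏ` varies by a bounded factor only,
bounds the derivative of this map by `O(k)` times its norm, so the second derivatives `∂_j ∂̄_l` of
the potential of the Bergman metric are `O(k²)` and the volume ratio is `O(k⁴)`. Dividing by `k⁴ log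
k`, the limit is `0`.
-/

noncomputable section

namespace Picard

section ComplexAnalysis

variable {V W : Type*} [NormedAddCommGroup V] [NormedSpace ℂ V]
  [NormedAddCommGroup W] [NormedSpace ℂ W]

lemma norm_fderiv_le_of_forall_mem_ball {f : V → W} {z : V} {r C : ℝ} (hr : 0 < r)
    (hf : DifferentiableOn ℂ f (Metric.ball z r)) (hC : ∀ x ∈ Metric.ball z r, ‖f x‖ ≤ C) :
    ‖fderiv ℂ f z‖ ≤ 2 * C / r := by
  refine Complex.norm_fderiv_le_div_of_mapsTo_ball hf (fun x hx => ?_) hr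
  rw [mem_closedBall_iff_norm]
  linarith [norm_sub_le (f x) (f z), hC x hx, hC z (Metric.mem_ball_self hr)]

-- The Schwarz lemma for a function that agrees with its value at the center to second order.
lemma norm_sub_sub_fderiv_le {f : V → W} {z w : V} {r M : ℝ}
    (hf : DifferentiableOn ℂ f (Metric.ball z r))
    (hM : Set.MapsTo f (Metric.ball z r) (Metric.closedBall (f z) M))
    (hw : w ∈ Metric.ball z r) :
    ‖f w - f z - fderiv ℂ f z (w - z)‖ ≤ 2 * M * (dist w z / r) ^ 2 := by
  have hr : 0 < r := Metric.nonempty_ball.1 ⟨w, hw⟩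
  have hz : DifferentiableAt ℂ f z := hf.differentiableAt (Metric.ball_mem_nhds z hr)
  have hderiv : ‖fderiv ℂ f z‖ ≤ M / r := Complex.norm_fderiv_le_div_of_mapsTo_ball hf hM hr
  let φ : V → W := fun x => f x - fderiv ℂ f z (x - z)
  have hφz : φ z = f z := by simp [φ]
  have hφ : Set.MapsTo φ (Metric.ball z r) (Metric.closedBall (φ z) (2 * M)) := fun x hx => by
    rw [hφz, mem_closedBall_iff_norm]
    have hfx : ‖f x - f z‖ ≤ M := mem_closedBall_iff_norm.1 (hM hx)
    have hlin : ‖fderiv ℂ f z (x - z)‖ ≤ M :=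
      calc ‖fderiv ℂ f z (x - z)‖ ≤ M / r * r :=
            (fderiv ℂ f z).le_of_opNorm_le_of_le hderiv (mem_ball_iff_norm.1 hx).le
        _ = M := div_mul_cancel₀ M hr.ne'
    calc ‖φ x - f z‖ = ‖(f x - f z) - fderiv ℂ f z (x - z)‖ := by simp only [φ]; congr 1; abel
      _ ≤ 2 * M := by linarith [norm_sub_le (f x - f z) (fderiv ℂ f z (x - z))]
  have hsmall : (φ · - φ z) =o[𝓝 z] fun x => ‖x - z‖ ^ 1 := by
    simp only [pow_one, hφz, φ]
    exact (hz.hasFDerivAt.isLittleO.norm_right).congr_left fun x => by abel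
  have hφd : DifferentiableOn ℂ φ (Metric.ball z r) := hf.sub (by fun_prop)
  have h := Complex.dist_le_mul_div_pow_of_mapsTo_ball_of_isLittleO hφd hφ hsmall hw
  rw [hφz, dist_eq_norm] at h
  calc ‖f w - f z - fderiv ℂ f z (w - z)‖ = ‖φ w - f z‖ := by simp only [φ]; congr 1; abel
    _ ≤ 2 * M * (dist w z / r) ^ 2 := h

section UniformLimit

variable {ι : Type*} {l : Filter ι} {F : ι → V → W} {U : Set V}

lemma uniformCauchySeqOn_fderiv_ball (hF : ∀ᶠ n in l, DifferentiableOn ℂ (F n) U)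
    (h : UniformCauchySeqOn F l U) {z : V} {r : ℝ} (hr : 0 < r)
    (hU : Metric.ball z (r + r) ⊆ U) :
    UniformCauchySeqOn (fun n => fderiv ℂ (F n)) l (Metric.ball z r) := by
  intro u hu
  obtain ⟨ε, hε, hεu⟩ := Metric.mem_uniformity_dist.1 hu
  filter_upwards [h _ (Metric.dist_mem_uniformity (by positivity : 0 < ε * r / 4)),
    hF.prod_mk hF] with n hn hdn x hx
  have hxU : Metric.ball x r ⊆ U := (Metric.ball_subset_ball' (by
    linarith [Metric.mem_ball.1 hx])).trans hU
  have hd (m : ι) (hm : DifferentiableOn ℂ (F m) U) : DifferentiableAt ℂ (F m) x :=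
    (hm.mono hxU).differentiableAt (Metric.ball_mem_nhds x hr)
  have hbound := norm_fderiv_le_of_forall_mem_ball (f := F n.1 - F n.2) hr
    ((hdn.1.sub hdn.2).mono hxU) fun y hy => (dist_eq_norm (F n.1 y) _ ▸ (hn y (hxU hy)).le)
  rw [fderiv_sub (hd _ hdn.1) (hd _ hdn.2), ← dist_eq_norm] at hbound
  refine hεu (hbound.trans_lt ?_)
  rw [show 2 * (ε * r / 4) / r = ε / 2 by field_simp; norm_num]
  exact half_lt_self hε

variable [CompleteSpace W] [l.NeBot] {f : V → W}

theorem differentiableOn_of_tendstoUniformlyOn (hU : IsOpen U)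
    (hF : ∀ᶠ n in l, DifferentiableOn ℂ (F n) U) (h : TendstoUniformlyOn F f l U) :
    DifferentiableOn ℂ f U := by
  intro z hz
  obtain ⟨ε, hε, hεU⟩ := Metric.isOpen_iff.1 hU z hz
  set r := ε / 2
  have hr : 0 < r := half_pos hε
  have hrU : Metric.ball z (r + r) ⊆ U := by rwa [add_halves]
  have hball : Metric.ball z r ⊆ U := (Metric.ball_subset_ball (by linarith)).trans hrU
  have hcauchy := uniformCauchySeqOn_fderiv_ball hF h.uniformCauchySeqOn hr hrU
  have hlim : ∀ x, ∃ g, x ∈ Metric.ball z r → Tendsto (fun n => fderiv ℂ (F n) x) l (𝓝 g) :=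
    fun x => by
      by_cases hx : x ∈ Metric.ball z r
      · obtain ⟨g, hg⟩ := cauchy_map_iff_exists_tendsto.1 (hcauchy.cauchy_map hx)
        exact ⟨g, fun _ => hg⟩
      · exact ⟨0, fun hx' => absurd hx' hx⟩
  choose f' hf' using hlim
  have hunif := hcauchy.tendstoUniformlyOn_of_tendsto hf'
  have hball_nhds := Metric.ball_mem_nhds z hr
  have hunif_nhds := hunif.tendstoUniformlyOnFilter.mono_right (le_principal_iff.2 hball_nhds)
  refine (hasFDerivAt_of_tendstoUniformlyOnFilter (f := F) hunif_nhds
    ?_ ?_).differentiableAt.differentiableWithinAt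
  · filter_upwards [hF.prod_mk hball_nhds] with p hp
    exact ((hp.1.mono hball).differentiableAt (Metric.isOpen_ball.mem_nhds hp.2)).hasFDerivAt
  · filter_upwards [hball_nhds] with x hx
    exact h.tendsto_at (hball hx)

end UniformLimit

lemma differentiableOn_tsum_of_summable_of_norm_le [CompleteSpace W] {ι : Type*} {f : ι → V → W}
    {u : ι → ℝ} {U : Set V} (hU : IsOpen U) (hu : Summable u)
    (hf : ∀ i, DifferentiableOn ℂ (f i) U) (hfu : ∀ i, ∀ x ∈ U, ‖f i x‖ ≤ u i) :
    DifferentiableOn ℂ (fun x => ∑' i, f i x) U :=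
  differentiableOn_of_tendstoUniformlyOn hU
    (Eventually.of_forall fun _ => DifferentiableOn.fun_sum fun i _ => hf i)
    (tendstoUniformlyOn_tsum hu hfu)

lemma eventually_norm_smul_lt (v : V) {r : ℝ} (hr : 0 < r) : ∀ᶠ t : ℂ in 𝓝[≠] 0, ‖t • v‖ < r :=
  eventually_nhdsWithin_of_eventually_nhds
    ((Continuous.tendsto' (by fun_prop) _ _ (by simp)).eventually_lt_const hr)

-- The difference quotients of `f` converge uniformly, at a rate given by the Schwarz lemma.
lemma tendstoUniformlyOn_slope {f : V → W} {U : Set V} {r M : ℝ} (hr : 0 < r)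
    (hf : ∀ x ∈ U, DifferentiableOn ℂ f (Metric.ball x r))
    (hM : ∀ x ∈ U, Set.MapsTo f (Metric.ball x r) (Metric.closedBall (f x) M)) (v : V) :
    TendstoUniformlyOn (fun (t : ℂ) x => t⁻¹ • (f (x + t • v) - f x))
      (fun x => fderiv ℂ f x v) (𝓝[≠] 0) U := by
  have hrate : Tendsto (fun t : ℂ => 2 * M * (‖v‖ / r) ^ 2 * ‖t‖) (𝓝[≠] 0) (𝓝 0) :=
    tendsto_nhdsWithin_of_tendsto_nhds (Continuous.tendsto' (by fun_prop) _ _ (by simp))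
  rw [Metric.tendstoUniformlyOn_iff]
  intro ε hε
  filter_upwards [hrate.eventually_lt_const hε, eventually_norm_smul_lt v hr,
    self_mem_nhdsWithin] with t ht htv ht0 x hx
  have ht0 : t ≠ 0 := ht0
  have htaylor := norm_sub_sub_fderiv_le (w := x + t • v) (hf x hx) (hM x hx) (by simpa using htv)
  rw [add_sub_cancel_left, dist_self_add_left, map_smul, norm_smul] at htaylor
  refine lt_of_le_of_lt ?_ ht
  calc dist (fderiv ℂ f x v) (t⁻¹ • (f (x + t • v) - f x))
      = ‖t‖⁻¹ * ‖f (x + t • v) - f x - t • fderiv ℂ f x v‖ := by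
        rw [dist_comm, dist_eq_norm, ← norm_inv, ← norm_smul, smul_sub _ _ (t • _),
          inv_smul_smul₀ ht0]
    _ ≤ ‖t‖⁻¹ * (2 * M * (‖t‖ * ‖v‖ / r) ^ 2) := by gcongr
    _ = 2 * M * (‖v‖ / r) ^ 2 * ‖t‖ := by
        have : ‖t‖ ≠ 0 := norm_ne_zero_iff.2 ht0
        field_simp

theorem differentiableOn_fderiv_apply [CompleteSpace W] {f : V → W} {U : Set V} (hU : IsOpen U)
    (hf : DifferentiableOn ℂ f U) (v : V) : DifferentiableOn ℂ (fun x => fderiv ℂ f x v) U := by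
  intro z hz
  obtain ⟨δ, hδ, hδU⟩ := Metric.mem_nhds_iff.1 (hU.mem_nhds hz)
  obtain ⟨ε, hε, hεf⟩ := Metric.continuousAt_iff.1
    (hf.continuousOn.continuousAt (hU.mem_nhds hz)) 1 one_pos
  set r := min δ ε / 2
  have hr : 0 < r := by positivity
  have hrr : r + r = min δ ε := add_halves _
  have hball : ∀ x ∈ Metric.ball z r, Metric.ball x r ⊆ Metric.ball z (min δ ε) := fun x hx =>
    Metric.ball_subset_ball' (by linarith [Metric.mem_ball.1 hx])
  have hsub : Metric.ball z (min δ ε) ⊆ U :=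
    (Metric.ball_subset_ball (min_le_left _ _)).trans hδU
  have hdist : ∀ x ∈ Metric.ball z (min δ ε), dist (f x) (f z) ≤ 1 := fun x hx =>
    (hεf ((Metric.mem_ball.1 hx).trans_le (min_le_right _ _))).le
  have hslope := tendstoUniformlyOn_slope (M := 2) hr
    (fun x hx => hf.mono ((hball x hx).trans hsub)) (fun x hx y hy => by
      rw [Metric.mem_closedBall]
      linarith [dist_triangle_right (f y) (f x) (f z), hdist y (hball x hx hy),
        hdist x (hball x hx (Metric.mem_ball_self hr))]) v
  refine ((differentiableOn_of_tendstoUniformlyOn Metric.isOpen_ball ?_ hslope).differentiableAt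
    (Metric.ball_mem_nhds z hr)).differentiableWithinAt
  filter_upwards [eventually_norm_smul_lt v hr] with t ht
  have hself : Set.MapsTo (fun x => x) (Metric.ball z r) U := fun x hx =>
    hsub (hball x hx (Metric.mem_ball_self hr))
  have hshift : Set.MapsTo (fun x => x + t • v) (Metric.ball z r) U := fun x hx =>
    hsub (hball x hx (by simpa using ht))
  exact ((hf.comp (by fun_prop) hshift).sub (hf.mono hself)).const_smul _

end ComplexAnalysis

section MeanValue

variable {V W : Type*} [NormedAddCommGroup V] [NormedSpace ℂ V] [NormedAddCommGroup W]
  [NormedSpace ℂ W] [CompleteSpace W]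

lemma circleAverage_smul_eq {h : V → W} {U : Set V} (hU : IsOpen U)
    (hbal : Balanced ℂ U) (hh : DifferentiableOn ℂ h U) {u : V} (hu : u ∈ U) :
    Real.circleAverage (fun t : ℂ => h (t • u)) 0 1 = h 0 := by
  have hline : DifferentiableOn ℂ (fun t : ℂ => h (t • u)) (Metric.closedBall 0 1) := fun t ht =>
    ((hh.differentiableAt (hU.mem_nhds (hbal.smul_mem (by simpa using ht) hu))).comp t
      (by fun_prop)).differentiableWithinAt
  have hd : DiffContOnCl ℂ (fun t : ℂ => h (t • u)) (Metric.ball 0 |1|) := by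
    rw [abs_one]
    exact hline.diffContOnCl_ball le_rfl
  rw [hd.circleAverage, zero_smul]

section Average

variable [MeasurableSpace V] [BorelSpace V] [SecondCountableTopology V] {μ : Measure V} [SFinite μ]
  [SMulInvariantMeasure Circle V μ]

lemma integral_eq_integral_circleAverage {g : V → W} (hg : Integrable g μ) :
    ∫ u, g u ∂μ = ∫ u, Real.circleAverage (fun t => g (t • u)) 0 1 ∂μ := by
  set ν : Measure ℝ := volume.restrict (Set.Ioc 0 (2 * Real.pi))
  have hcircle (θ : ℝ) (u : V) : circleMap 0 1 θ • u = Circle.exp θ • u := by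
    simp [circleMap, Circle.smul_def]
  have hrot : MeasurePreserving (fun p : ℝ × V => (p.1, Circle.exp p.1 • p.2)) (ν.prod μ)
      (ν.prod μ) :=
    (MeasurePreserving.id ν).skew_product (Continuous.measurable (by fun_prop))
      (Eventually.of_forall fun θ => (measurePreserving_smul (Circle.exp θ) μ).map_eq)
  have hint : Integrable (fun p : ℝ × V => g (Circle.exp p.1 • p.2)) (ν.prod μ) :=
    hrot.integrable_comp_of_integrable (hg.comp_snd ν)
  have hslice (θ : ℝ) : ∫ u, g (Circle.exp θ • u) ∂μ = ∫ u, g u ∂μ := integral_smul_eq_self g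
  have hpi : (0 : ℝ) ≤ 2 * Real.pi := Real.two_pi_pos.le
  simp only [Real.circleAverage_def, hcircle, integral_smul, intervalIntegral.integral_of_le hpi]
  rw [← integral_integral_swap hint]
  simp only [hslice, setIntegral_const, Real.volume_real_Ioc_of_le hpi, sub_zero,
    inv_smul_smul₀ Real.two_pi_pos.ne']

theorem integral_smul_eq_integral_smul_apply_zero {h : V → W} {ρ : V → ℝ}
    {U : Set V} (hU : IsOpen U) (hbal : Balanced ℂ U) (hμ : ∀ᵐ u ∂μ, u ∈ U)
    (hh : DifferentiableOn ℂ h U) (hρ : ∀ (c : Circle) u, ρ (c • u) = ρ u)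
    (hint : Integrable (fun u => ρ u • h u) μ) :
    ∫ u, ρ u • h u ∂μ = (∫ u, ρ u ∂μ) • h 0 := by
  rw [integral_eq_integral_circleAverage hint, ← integral_smul_const]
  refine integral_congr_ae (hμ.mono fun u hu => ?_)
  have hρu (t : ℂ) (ht : t ∈ Metric.sphere 0 |1|) : ρ (t • u) • h (t • u) = ρ u • h (t • u) := by
    rw [← hρ ⟨t, by simpa [Submonoid.unitSphere] using ht⟩ u]
    rfl
  change Real.circleAverage (fun t : ℂ => ρ (t • u) • h (t • u)) 0 1 = ρ u • h 0
  rw [Real.circleAverage_congr_sphere hρu, ← circleAverage_smul_eq hU hbal hh hu]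
  exact Real.circleAverage_fun_smul

end Average

instance : SMulInvariantMeasure Circle E volume where
  measure_preimage_smul c s hs := by
    let L : E ≃ₗᵢ[ℝ] E :=
      { (LinearEquiv.smulOfNeZero ℂ E (c : ℂ) c.coe_ne_zero).restrictScalars ℝ with
        norm_map' := fun x => by
          change ‖(c : ℂ) • x‖ = ‖x‖
          rw [norm_smul, Circle.norm_coe, one_mul] }
    exact L.measurePreserving.measure_preimage hs.nullMeasurableSet

instance (R : ℝ) : SMulInvariantMeasure Circle E (volume.restrict (Metric.ball 0 R)) where
  measure_preimage_smul c s hs := by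
    have hball : (c • ·) ⁻¹' Metric.ball (0 : E) R = Metric.ball 0 R := by
      ext u
      simp [Circle.smul_def, norm_smul, Circle.norm_coe]
    rw [Measure.restrict_apply (measurable_const_smul c hs), Measure.restrict_apply hs]
    nth_rw 1 [← hball]
    rw [← Set.preimage_inter]
    exact measure_preimage_smul_of_nullMeasurableSet
      (hs.inter Metric.isOpen_ball.measurableSet).nullMeasurableSet c

theorem enorm_mul_volume_ball_le {h : E → W} {w : E} {R : ℝ}
    (hh : DifferentiableOn ℂ h (Metric.ball w R)) :
    ‖h w‖ₑ * volume (Metric.ball (0 : E) R) ≤ ∫⁻ u in Metric.ball w R, ‖h u‖ₑ := by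
  have htranslate : ∫⁻ u in Metric.ball w R, ‖h u‖ₑ =
      ∫⁻ u in Metric.ball (0 : E) R, ‖h (w + u)‖ₑ := by
    rw [← (measurePreserving_add_left volume w).setLIntegral_comp_preimage_emb
      (measurableEmbedding_addLeft w) (fun u => ‖h u‖ₑ)]
    simp
  have hd : DifferentiableOn ℂ (fun u => h (w + u)) (Metric.ball 0 R) :=
    hh.comp (by fun_prop) fun u hu => by simpa using hu
  rw [htranslate]
  by_cases hfin : ∫⁻ u in Metric.ball (0 : E) R, ‖h (w + u)‖ₑ = ⊤
  · exact hfin ▸ le_top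
  have hint : IntegrableOn (fun u => h (w + u)) (Metric.ball 0 R) :=
    ⟨hd.continuousOn.aestronglyMeasurable Metric.isOpen_ball.measurableSet,
      lt_top_iff_ne_top.2 hfin⟩
  have hmean := integral_smul_eq_integral_smul_apply_zero (ρ := fun _ => 1) Metric.isOpen_ball
    (balanced_ball_zero) (ae_restrict_mem Metric.isOpen_ball.measurableSet) hd
    (fun _ _ => rfl) (by simpa only [one_smul, IntegrableOn] using hint)
  simp only [one_smul, setIntegral_one_eq_measureReal, add_zero] at hmean
  calc ‖h w‖ₑ * volume (Metric.ball (0 : E) R)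
      = ‖volume.real (Metric.ball (0 : E) R) • h w‖ₑ := by
        rw [enorm_smul, Real.enorm_of_nonneg measureReal_nonneg,
          ofReal_measureReal measure_ball_lt_top.ne, mul_comm]
    _ ≤ ∫⁻ u in Metric.ball (0 : E) R, ‖h (w + u)‖ₑ :=
        hmean ▸ enorm_integral_le_lintegral_enorm _

end MeanValue

section Action

/-- The denominator `Cz + D` of the fractional linear transformation of `g`: the automorphy factor
of the action. -/
def den (g : SU21) (z : E) : ℂ := (mat g *ᵥ lift z) 2

lemma mulVec_lift (A : Matrix (Fin 3) (Fin 3) ℂ) (z : E) (i : Fin 3) :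
    (A *ᵥ lift z) i = A i 0 * z 0 + A i 1 * z 1 + A i 2 := by
  simp [mulVec, dotProduct, Fin.sum_univ_three, lift]

lemma den_eq (g : SU21) (z : E) : den g z = mat g 2 0 * z 0 + mat g 2 1 * z 1 + mat g 2 2 :=
  mulVec_lift _ _ _

lemma den_ne_zero (g : SU21) {z : E} (hz : z ∈ Metric.ball (0 : E) 1) : den g z ≠ 0 :=
  denom_ne_zero g ⟨z, hz⟩

lemma norm_den_pos (g : SU21) (z : Ball2) : 0 < ‖den g z.1‖ :=
  norm_pos_iff.2 (den_ne_zero g z.2)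

lemma moebius_apply (g : SU21) (z : E) (i : Fin 2) : moebius (mat g) z i =
    (mat g i.castSucc 0 * z 0 + mat g i.castSucc 1 * z 1 + mat g i.castSucc 2) / den g z := by
  fin_cases i <;> simp [moebius, mulVec_lift, den_eq]

lemma smul_val (g : SU21) (z : Ball2) : (g • z).1 = moebius (mat g) z.1 := rfl

lemma norm_sq_eq (z : E) : ‖z‖ ^ 2 = ‖z 0‖ ^ 2 + ‖z 1‖ ^ 2 := by
  rw [EuclideanSpace.norm_sq_eq, Fin.sum_univ_two]

/-- The factor `1 - |z|²`, whose cube is the squared norm of `dz₁ ∧ dz₂` in the hyperbolic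
metric. -/
def weight (z : Ball2) : ℝ := 1 - ‖z.1‖ ^ 2

lemma weight_pos (z : Ball2) : 0 < weight z := by
  rw [weight, sub_pos, sq_lt_one_iff₀ (norm_nonneg _)]
  exact mem_ball_zero_iff.1 z.2

lemma weight_le_one (z : Ball2) : weight z ≤ 1 :=
  sub_le_self _ (sq_nonneg _)

lemma continuous_weight : Continuous weight := by
  unfold weight
  fun_prop

lemma weight_smul (g : SU21) (z : Ball2) : weight (g • z) * ‖den g z.1‖ ^ 2 = weight z := by
  have hform := norm_mulVec_lift g z.1
  have hden := (norm_den_pos g z).ne'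
  rw [weight, weight, smul_val, norm_sq_eq, norm_sq_eq]
  simp only [moebius, PiLp.toLp_apply, Matrix.cons_val_zero, Matrix.cons_val_one, norm_div]
  rw [← den] at hform ⊢
  field_simp
  linarith

lemma differentiableAt_moebius (g : SU21) {z : E} (hz : z ∈ Metric.ball (0 : E) 1) :
    DifferentiableAt ℂ (moebius (mat g)) z := by
  rw [differentiableAt_euclidean]
  intro i
  have hden := den_ne_zero g hz
  simp only [moebius_apply, den_eq, div_eq_mul_inv] at hden ⊢
  fun_prop (disch := exact hden)

lemma fderiv_moebius_apply (g : SU21) {z : E} (hz : z ∈ Metric.ball (0 : E) 1) (v : E)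
    (i : Fin 2) : fderiv ℂ (moebius (mat g)) z v i =
      ((mat g i.castSucc 0 * v 0 + mat g i.castSucc 1 * v 1) * den g z -
        (mat g i.castSucc 0 * z 0 + mat g i.castSucc 1 * z 1 + mat g i.castSucc 2) *
          (mat g 2 0 * v 0 + mat g 2 1 * v 1)) / den g z ^ 2 := by
  have haff (a b c : ℂ) : HasDerivAt
      (fun t : ℂ => a * (z + t • v) 0 + b * (z + t • v) 1 + c) (a * v 0 + b * v 1) 0 := by
    have hcoord (j : Fin 2) : HasDerivAt (fun t : ℂ => (z + t • v) j) (v j) 0 := by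
      simpa using ((hasDerivAt_id (0 : ℂ)).mul_const (v j)).const_add (z j)
    exact (((hcoord 0).const_mul a).add ((hcoord 1).const_mul b)).add_const c
  have hquot := (haff (mat g i.castSucc 0) (mat g i.castSucc 1) (mat g i.castSucc 2)).div
    (haff (mat g 2 0) (mat g 2 1) (mat g 2 2)) (by simpa [← den_eq] using den_ne_zero g hz)
  have hline : HasLineDerivAt ℂ (fun x => moebius (mat g) x i)
      (fderiv ℂ (moebius (mat g)) z v i) z v :=
    ((EuclideanSpace.proj i : E →L[ℂ] ℂ).hasFDerivAt.comp z
      (differentiableAt_moebius g hz).hasFDerivAt).hasLineDerivAt v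
  simp only [HasLineDerivAt, moebius_apply, den_eq] at hline
  rw [hline.unique hquot]
  simp [den_eq]

lemma det_mat (g : SU21) : (mat g).det = 1 := g.1.2

lemma jacobian_eq (g : SU21) (z : Ball2) : jacobian g z = (den g z.1 ^ 3)⁻¹ := by
  have hden := den_ne_zero g z.2
  have hdet := det_mat g
  rw [jacobian, ContinuousLinearMap.det,
    ← LinearMap.det_toMatrix (EuclideanSpace.basisFun (Fin 2) ℂ).toBasis, det_fin_two]
  simp only [LinearMap.toMatrix_apply, OrthonormalBasis.coe_toBasis,
    OrthonormalBasis.coe_toBasis_repr_apply, EuclideanSpace.basisFun_repr,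
    EuclideanSpace.basisFun_apply, ContinuousLinearMap.coe_coe, fderiv_moebius_apply g z.2]
  rw [det_fin_three] at hdet
  simp only [Fin.isValue, Fin.castSucc_zero, PiLp.single_eq_same, mul_one, ne_eq, one_ne_zero,
    not_false_eq_true, PiLp.single_eq_of_ne, mul_zero, add_zero, Fin.castSucc_one, zero_ne_one,
    zero_add]
  field_simp
  rw [den_eq] at *
  linear_combination (mat g 2 0 * z.1 0 + mat g 2 1 * z.1 1 + mat g 2 2) * hdet

lemma jacobian_ne_zero (g : SU21) (z : Ball2) : jacobian g z ≠ 0 := by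
  rw [jacobian_eq]
  exact inv_ne_zero (pow_ne_zero _ (den_ne_zero g z.2))

lemma den_mul (g h : SU21) (z : Ball2) :
    den (g * h) z.1 = den g (h • z).1 * den h z.1 := by
  have hden : (mat h *ᵥ lift z.1) 2 ≠ 0 := den_ne_zero h z.2
  rw [den, den, den, smul_val, lift_moebius, mulVec_smul, mat_mul, ← mulVec_mulVec,
    Pi.smul_apply, smul_eq_mul]
  field_simp

lemma jacobian_mul (g h : SU21) (z : Ball2) :
    jacobian (g * h) z = jacobian g (h • z) * jacobian h z := by
  rw [jacobian_eq, jacobian_eq, jacobian_eq, den_mul, mul_pow, mul_inv]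

lemma jacobian_one (z : Ball2) : jacobian 1 z = 1 := by
  have h := jacobian_mul 1 1 z
  rw [one_mul, one_smul] at h
  exact (mul_eq_right₀ (jacobian_ne_zero 1 z)).1 h.symm

lemma weight_smul_pow_three (g : SU21) (z : Ball2) :
    weight (g • z) ^ 3 = weight z ^ 3 * ‖jacobian g z‖ ^ 2 := by
  have hden := (norm_den_pos g z).ne'
  rw [← weight_smul g z, jacobian_eq, norm_inv, norm_pow]
  field_simp

instance : ContinuousConstSMul SU21 Ball2 where
  continuous_const_smul g := Continuous.subtype_mk (continuous_iff_continuousAt.2 fun z =>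
    (differentiableAt_moebius g z.2).continuousAt.comp continuousAt_subtype_val) _

lemma isHolomorphic_jacobian (g : SU21) : IsHolomorphic (jacobian g) := by
  have hden : DifferentiableOn ℂ (fun z => (den g z ^ 3)⁻¹) (Metric.ball 0 1) := by
    refine DifferentiableOn.inv (DifferentiableOn.pow ?_ 3) fun z hz =>
      pow_ne_zero _ (den_ne_zero g hz)
    simp only [funext (den_eq g)]
    fun_prop
  exact hden.congr fun z hz => by rw [extendZero_apply _ hz, jacobian_eq]

lemma IsHolomorphic.continuous {f : Ball2 → ℂ} (hf : IsHolomorphic f) : Continuous f := by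
  convert continuousOn_iff_continuous_domRestrict.1 hf.continuousOn using 1
  ext z
  rw [Set.domRestrict_apply, extendZero_apply _ z.2]

end Action

section Transitivity

/-- The center of the ball. -/
def origin : Ball2 := ⟨0, Metric.mem_ball_self one_pos⟩

lemma weight_origin : weight origin = 1 := by simp [weight, origin]

/-- The Hermitian matrix with blocks `1 + p z z*`, `q z`, `q z*` and `q`. For
`q = (1 - |z|²)^(-1/2)` and `p = q² / (1 + q)` it is the Lorentz boost that moves the center of the
ball to `z`. -/
def boostMatrix (p q : ℝ) (z : E) : Matrix (Fin 3) (Fin 3) ℂ :=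
  !![1 + p * z 0 * star (z 0), p * z 0 * star (z 1), q * z 0;
    p * z 1 * star (z 0), 1 + p * z 1 * star (z 1), q * z 1;
    q * star (z 0), q * star (z 1), q]

section

variable {p q : ℝ} {z : E}

lemma ofReal_norm_sq_eq (z : E) : ((‖z‖ ^ 2 : ℝ) : ℂ) = z 0 * star (z 0) + z 1 * star (z 1) := by
  simp only [norm_sq_eq, Complex.star_def, Complex.mul_conj, Complex.normSq_eq_norm_sq,
    Complex.ofReal_add]

lemma det_boostMatrix (hp : p * ‖z‖ ^ 2 = q - 1) (hq : q ^ 2 * ‖z‖ ^ 2 = q ^ 2 - 1) :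
    (boostMatrix p q z).det = 1 := by
  have hp' := congrArg Complex.ofReal hp
  have hq' := congrArg Complex.ofReal hq
  simp only [Complex.ofReal_mul, ofReal_norm_sq_eq, Complex.ofReal_sub, Complex.ofReal_one,
    Complex.ofReal_pow q] at hp' hq'
  rw [det_fin_three]
  simp [boostMatrix] at hp' hq' ⊢
  linear_combination q * hp' - hq'

lemma conjTranspose_boostMatrix : (boostMatrix p q z)ᴴ = boostMatrix p q z := by
  ext i j
  fin_cases i <;> fin_cases j <;> simp [boostMatrix, conjTranspose_apply] <;> ring

lemma boostMatrix_unitary (hp : p * ‖z‖ ^ 2 = q - 1) (hq : q ^ 2 * ‖z‖ ^ 2 = q ^ 2 - 1)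
    (hpq : p * (1 + q) = q ^ 2) :
    (boostMatrix p q z)ᴴ * H * boostMatrix p q z = H := by
  have hp' := congrArg Complex.ofReal hp
  have hq' := congrArg Complex.ofReal hq
  have hpq' := congrArg Complex.ofReal hpq
  simp only [Complex.ofReal_mul, ofReal_norm_sq_eq, Complex.ofReal_sub, Complex.ofReal_one,
    Complex.ofReal_pow q, Complex.ofReal_add, Complex.star_def] at hp' hq' hpq'
  have hquad (x y : ℂ) : x * y * ((2 : ℂ) * p + p * (p * (z 0 * starRingEnd ℂ (z 0) +
      z 1 * starRingEnd ℂ (z 1))) - q ^ 2) = 0 := by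
    rw [hp']
    linear_combination x * y * hpq'
  rw [conjTranspose_boostMatrix]
  ext i j
  fin_cases i <;> fin_cases j <;>
    simp [boostMatrix, H, Matrix.mul_apply, Fin.sum_univ_three, vecMul_diagonal]
  · linear_combination hquad (z 0) (starRingEnd ℂ (z 0))
  · linear_combination hquad (z 0) (starRingEnd ℂ (z 1))
  · linear_combination q * z 0 * hp'
  · linear_combination hquad (z 1) (starRingEnd ℂ (z 0))
  · linear_combination hquad (z 1) (starRingEnd ℂ (z 1))
  · linear_combination q * z 1 * hp'
  · linear_combination q * starRingEnd ℂ (z 0) * hp'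
  · linear_combination q * starRingEnd ℂ (z 1) * hp'
  · linear_combination hq'

end

theorem exists_smul_origin_eq (z : Ball2) : ∃ g : SU21, g • origin = z := by
  set s := √(weight z)
  have hs : 0 < s := Real.sqrt_pos.2 (weight_pos z)
  have hT : ‖z.1‖ ^ 2 = 1 - s ^ 2 := by rw [Real.sq_sqrt (weight_pos z).le, weight]; ring
  set q := s⁻¹ with hq
  set p := q ^ 2 / (1 + q) with hp
  have hpT : p * ‖z.1‖ ^ 2 = q - 1 := by rw [hT, hp, hq]; field_simp; ring
  have hqT : q ^ 2 * ‖z.1‖ ^ 2 = q ^ 2 - 1 := by rw [hT, hq]; field_simp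
  have hpq : p * (1 + q) = q ^ 2 := by rw [hp, hq]; field_simp
  have hq0 : (q : ℂ) ≠ 0 := Complex.ofReal_ne_zero.2 (inv_pos.2 hs).ne'
  refine ⟨⟨⟨boostMatrix p q z.1, det_boostMatrix hpT hqT⟩, boostMatrix_unitary hpT hqT hpq⟩,
    Subtype.ext ?_⟩
  ext i
  fin_cases i <;>
    simp [smul_val, moebius, mulVec_lift, mat, boostMatrix, origin, mul_div_cancel_left₀ _ hq0]

end Transitivity

section Measure

/-- Lebesgue measure on the ball. -/
def eucMeasure : Measure Ball2 := Measure.comap (Subtype.val : Ball2 → E) volume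

lemma measurableSet_ball : MeasurableSet (Metric.ball (0 : E) 1) :=
  Metric.isOpen_ball.measurableSet

instance : IsFiniteMeasure eucMeasure where
  measure_univ_lt_top := by
    rw [eucMeasure, comap_subtype_coe_apply measurableSet_ball]
    exact (measure_mono (Set.image_subset_iff.2 fun z _ => z.2)).trans_lt
      (measure_ball_lt_top (x := (0 : E)) (r := 1))

lemma hypMeasure_eq_withDensity : hypMeasure =
    eucMeasure.withDensity fun z => ENNReal.ofReal ((weight z ^ 3)⁻¹) := rfl

lemma measurable_hypDensity : Measurable fun z : Ball2 => ENNReal.ofReal ((weight z ^ 3)⁻¹) :=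
  ENNReal.measurable_ofReal.comp (continuous_weight.measurable.pow_const 3).inv

lemma lintegral_hypMeasure (f : Ball2 → ENNReal) :
    ∫⁻ z, f z ∂hypMeasure = ∫⁻ z, ENNReal.ofReal ((weight z ^ 3)⁻¹) * f z ∂eucMeasure :=
  lintegral_withDensity_eq_lintegral_mul_non_measurable _ measurable_hypDensity
    (Eventually.of_forall fun _ => ENNReal.ofReal_lt_top) f

lemma integral_hypMeasure {W : Type*} [NormedAddCommGroup W] [NormedSpace ℝ W] (f : Ball2 → W) :
    ∫ z, f z ∂hypMeasure = ∫ z, (weight z ^ 3)⁻¹ • f z ∂eucMeasure := by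
  rw [hypMeasure_eq_withDensity, integral_withDensity_eq_integral_toReal_smul
    measurable_hypDensity (Eventually.of_forall fun _ => ENNReal.ofReal_lt_top)]
  congr with z
  rw [ENNReal.toReal_ofReal (inv_pos.2 (pow_pos (weight_pos z) 3)).le]

lemma integrable_hypMeasure_iff {W : Type*} [NormedAddCommGroup W] [NormedSpace ℝ W]
    {f : Ball2 → W} :
    Integrable f hypMeasure ↔ Integrable (fun z => (weight z ^ 3)⁻¹ • f z) eucMeasure := by
  rw [hypMeasure_eq_withDensity, integrable_withDensity_iff_integrable_smul'
    measurable_hypDensity (Eventually.of_forall fun _ => ENNReal.ofReal_lt_top)]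
  congr! 2 with z
  rw [ENNReal.toReal_ofReal (inv_pos.2 (pow_pos (weight_pos z) 3)).le]

lemma lintegral_eucMeasure (f : E → ENNReal) :
    ∫⁻ z : Ball2, f z.1 ∂eucMeasure = ∫⁻ z in Metric.ball (0 : E) 1, f z :=
  lintegral_subtype_comap measurableSet_ball f

lemma integral_eucMeasure {W : Type*} [NormedAddCommGroup W] [NormedSpace ℝ W] (f : E → W) :
    ∫ z : Ball2, f z.1 ∂eucMeasure = ∫ z in Metric.ball (0 : E) 1, f z :=
  integral_subtype_comap measurableSet_ball f

lemma integrable_eucMeasure_iff {W : Type*} [NormedAddCommGroup W] {f : E → W} :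
    Integrable (fun z : Ball2 => f z.1) eucMeasure ↔ IntegrableOn f (Metric.ball 0 1) :=
  (integrableOn_iff_comap_subtypeVal measurableSet_ball).symm

lemma ofReal_abs_det_fderiv_moebius (g : SU21) (z : Ball2) :
    ENNReal.ofReal |((fderiv ℂ (moebius (mat g)) z.1).restrictScalars ℝ).det| =
      ‖jacobian g z‖ₑ ^ 2 := by
  have h := LinearMap.det_restrictScalars (R := ℝ)
    (f := (fderiv ℂ (moebius (mat g)) z.1 : E →ₗ[ℂ] E))
  rw [Algebra.norm_complex_apply, Complex.normSq_eq_norm_sq] at h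
  rw [← ofReal_norm, ← ENNReal.ofReal_pow (norm_nonneg _), jacobian, ContinuousLinearMap.det,
    ContinuousLinearMap.det]
  exact congrArg ENNReal.ofReal ((congrArg abs h).trans (abs_of_nonneg (sq_nonneg _)))

lemma image_moebius_ball (g : SU21) :
    moebius (mat g) '' Metric.ball (0 : E) 1 = Metric.ball (0 : E) 1 := by
  refine Set.Subset.antisymm (Set.image_subset_iff.2 fun y hy => moebius_mem_ball g ⟨y, hy⟩)
    fun x hx => ⟨(g⁻¹ • (⟨x, hx⟩ : Ball2)).1, (g⁻¹ • (⟨x, hx⟩ : Ball2)).2, ?_⟩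
  rw [← smul_val, smul_inv_smul]

lemma injOn_moebius_ball (g : SU21) : Set.InjOn (moebius (mat g)) (Metric.ball (0 : E) 1) :=
  fun x hx y hy hxy => congrArg Subtype.val
    (smul_left_cancel g (Subtype.ext hxy : g • (⟨x, hx⟩ : Ball2) = g • (⟨y, hy⟩ : Ball2)))

lemma lintegral_enorm_jacobian_sq_mul (g : SU21) (φ : Ball2 → ENNReal) :
    ∫⁻ z, ‖jacobian g z‖ₑ ^ 2 * φ (g • z) ∂eucMeasure = ∫⁻ z, φ z ∂eucMeasure := by
  have hφ (z : Ball2) : Function.extend Subtype.val φ 0 z.1 = φ z :=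
    Subtype.val_injective.extend_apply φ 0 z
  have h := lintegral_image_eq_lintegral_abs_det_fderiv_mul volume measurableSet_ball
    (fun x hx => ((differentiableAt_moebius g hx).hasFDerivAt.restrictScalars
      ℝ).hasFDerivWithinAt) (injOn_moebius_ball g) (Function.extend Subtype.val φ 0)
  rw [image_moebius_ball, ← lintegral_eucMeasure, ← lintegral_eucMeasure] at h
  simp only [hφ, ofReal_abs_det_fderiv_moebius, ← smul_val] at h
  exact h.symm

lemma lintegral_smul_hypMeasure (g : SU21) (φ : Ball2 → ENNReal) :
    ∫⁻ z, φ (g • z) ∂hypMeasure = ∫⁻ z, φ z ∂hypMeasure := by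
  rw [lintegral_hypMeasure, lintegral_hypMeasure,
    ← lintegral_enorm_jacobian_sq_mul g fun z => ENNReal.ofReal ((weight z ^ 3)⁻¹) * φ z]
  refine lintegral_congr fun z => ?_
  have hw := weight_pos z
  have hj : 0 < ‖jacobian g z‖ := norm_pos_iff.2 (jacobian_ne_zero g z)
  rw [← mul_assoc, ← ofReal_norm, ← ENNReal.ofReal_pow hj.le, ← ENNReal.ofReal_mul (by positivity),
    weight_smul_pow_three]
  congr 2
  field_simp

instance : SMulInvariantMeasure SU21 Ball2 hypMeasure where
  measure_preimage_smul g s (hs : MeasurableSet s) := by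
    have h := lintegral_smul_hypMeasure g (s.indicator 1)
    rw [lintegral_indicator_one hs] at h
    rw [← h, ← lintegral_indicator_one (hs.preimage (measurable_const_smul g))]
    rfl

instance (Γ : Subgroup SU21) : ContinuousConstSMul Γ Ball2 where
  continuous_const_smul γ := continuous_const_smul (γ : SU21)

instance (Γ : Subgroup SU21) : SMulInvariantMeasure Γ Ball2 hypMeasure where
  measure_preimage_smul γ s _ := measure_preimage_smul hypMeasure (γ : SU21) s

end Measure

section MatrixEntries

lemma H_mul_H : H * H = 1 := by
  rw [H, diagonal_mul_diagonal, ← diagonal_one]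
  congr 1
  ext i
  fin_cases i <;> simp

lemma mat_inv (g : SU21) : mat g⁻¹ = H * (mat g)ᴴ * H := by
  have hg : (mat g)ᴴ * H * mat g = H := g.2
  have hleft : H * (mat g)ᴴ * H * mat g = 1 := by
    rw [Matrix.mul_assoc H, Matrix.mul_assoc, hg, H_mul_H]
  have hright : mat g * mat g⁻¹ = 1 := by
    rw [← mat_mul, mul_inv_cancel]
    simp [mat]
  exact (left_inv_eq_right_inv hleft hright).symm

lemma norm_mat_inv_apply (g : SU21) (i : Fin 3) : ‖mat g⁻¹ i 2‖ = ‖mat g 2 i‖ := by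
  rw [mat_inv]
  fin_cases i <;> simp [H, conjTranspose_apply]

lemma norm_sq_col_eq (g : SU21) (j : Fin 3) :
    ‖mat g 0 j‖ ^ 2 + ‖mat g 1 j‖ ^ 2 - ‖mat g 2 j‖ ^ 2 =
      ‖(Pi.single j 1 : Fin 3 → ℂ) 0‖ ^ 2 + ‖(Pi.single j 1 : Fin 3 → ℂ) 1‖ ^ 2 -
        ‖(Pi.single j 1 : Fin 3 → ℂ) 2‖ ^ 2 := by
  have h := hermForm_mulVec g (Pi.single j 1)
  rw [hermForm_eq, hermForm_eq] at h
  simpa only [mulVec_single_one, col_apply] using Complex.ofReal_injective h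

lemma norm_sq_col_le (g : SU21) (j : Fin 3) :
    ‖mat g 0 j‖ ^ 2 + ‖mat g 1 j‖ ^ 2 ≤ 1 + ‖mat g 2 j‖ ^ 2 := by
  have h := norm_sq_col_eq g j
  fin_cases j <;> simp at h ⊢ <;> linarith

/-- The vector `c` for which the automorphy factor `Cz + D` is `⟪c, z⟫ + D`. -/
def row (g : SU21) : E := !₂[star (mat g 2 0), star (mat g 2 1)]

lemma norm_row_sq (g : SU21) : ‖row g‖ ^ 2 = ‖mat g 2 0‖ ^ 2 + ‖mat g 2 1‖ ^ 2 := by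
  simp [norm_sq_eq, row]

lemma den_eq_inner_add (g : SU21) (z : E) : den g z = inner ℂ (row g) z + mat g 2 2 := by
  simp [den_eq, row, PiLp.inner_apply, Fin.sum_univ_two, mul_comm]

lemma norm_row_sq_add_one (g : SU21) : ‖row g‖ ^ 2 + 1 = ‖mat g 2 2‖ ^ 2 := by
  have h := norm_sq_col_eq g⁻¹ 2
  simp only [norm_mat_inv_apply] at h
  rw [norm_row_sq]
  simp at h
  linarith

lemma one_le_norm_mat (g : SU21) : 1 ≤ ‖mat g 2 2‖ := by
  rw [← one_le_sq_iff₀ (norm_nonneg _), ← norm_row_sq_add_one]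
  linarith [sq_nonneg ‖row g‖]

lemma norm_row_le (g : SU21) : ‖row g‖ ≤ ‖mat g 2 2‖ := by
  rw [← sq_le_sq₀ (norm_nonneg _) (norm_nonneg _), ← norm_row_sq_add_one]
  linarith

lemma norm_mat_sub_le_norm_den (g : SU21) (z : E) :
    ‖mat g 2 2‖ - ‖row g‖ * ‖z‖ ≤ ‖den g z‖ := by
  have h := norm_sub_le (den g z) (inner ℂ (row g) z)
  rw [den_eq_inner_add, add_sub_cancel_left, ← den_eq_inner_add] at h
  linarith [norm_inner_le_norm (𝕜 := ℂ) (row g) z]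

lemma one_sub_norm_mul_norm_mat_le (g : SU21) (z : E) : (1 - ‖z‖) * ‖mat g 2 2‖ ≤ ‖den g z‖ := by
  linarith [norm_mat_sub_le_norm_den g z,
    mul_le_mul_of_nonneg_right (norm_row_le g) (norm_nonneg z)]

-- With `D = mat g 2 2` and `c = ‖row g‖`: `|Cz + D| ≥ |D| - c` and `(|D| - c) (|D| + c) = 1`.
lemma one_le_two_mul_norm_mat_mul_norm_den (g : SU21) (z : Ball2) :
    1 ≤ 2 * ‖mat g 2 2‖ * ‖den g z.1‖ := by
  have hden : ‖mat g 2 2‖ - ‖row g‖ ≤ ‖den g z.1‖ := by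
    linarith [norm_mat_sub_le_norm_den g z.1,
      mul_le_of_le_one_right (norm_nonneg (row g)) (mem_ball_zero_iff.1 z.2).le]
  calc (1 : ℝ) = (‖mat g 2 2‖ + ‖row g‖) * (‖mat g 2 2‖ - ‖row g‖) := by
        linear_combination norm_row_sq_add_one g
    _ ≤ (‖mat g 2 2‖ + ‖mat g 2 2‖) * ‖den g z.1‖ := by
        gcongr
        · exact sub_nonneg.2 (norm_row_le g)
        · exact norm_row_le g
    _ = 2 * ‖mat g 2 2‖ * ‖den g z.1‖ := by ring

lemma norm_mat_apply_sq_le (g : SU21) (i j : Fin 3) : ‖mat g i j‖ ^ 2 ≤ 1 + ‖mat g 2 2‖ ^ 2 := by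
  have hrow := norm_row_sq_add_one g
  rw [norm_row_sq] at hrow
  have hlast : ‖mat g 2 j‖ ^ 2 ≤ ‖mat g 2 2‖ ^ 2 := by
    fin_cases j <;> simp <;> nlinarith [sq_nonneg ‖mat g 2 0‖, sq_nonneg ‖mat g 2 1‖]
  have hcol := norm_sq_col_le g j
  fin_cases i <;> simp <;> nlinarith [sq_nonneg ‖mat g 0 j‖, sq_nonneg ‖mat g 1 j‖]

lemma norm_mat_sq_mul_le {g : SU21} {x : Ball2} {r : ℝ} (hr : r < 1) (hx : ‖x.1‖ ≤ r)
    (hgx : ‖(g • x).1‖ ≤ r) : ‖mat g 2 2‖ ^ 2 * ((1 - r) ^ 2 * (1 - r ^ 2)) ≤ 1 := by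
  have hr0 : 0 ≤ r := (norm_nonneg x.1).trans hx
  have hweight : 1 - r ^ 2 ≤ weight (g • x) := by
    rw [weight]
    gcongr
  have hden : (1 - r) * ‖mat g 2 2‖ ≤ ‖den g x.1‖ :=
    le_trans (by gcongr) (one_sub_norm_mul_norm_mat_le g x.1)
  have : 0 ≤ 1 - r ^ 2 := sub_nonneg.2 (pow_le_one₀ hr0 hr.le)
  calc ‖mat g 2 2‖ ^ 2 * ((1 - r) ^ 2 * (1 - r ^ 2))
      = (1 - r ^ 2) * ((1 - r) * ‖mat g 2 2‖) ^ 2 := by ring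
    _ ≤ weight (g • x) * ‖den g x.1‖ ^ 2 := by
        gcongr
        exact (weight_pos _).le
    _ = weight x := weight_smul g x
    _ ≤ 1 := weight_le_one x

end MatrixEntries

section ProperlyDiscontinuous

instance : SecondCountableTopology (Matrix (Fin 3) (Fin 3) ℂ) :=
  inferInstanceAs (SecondCountableTopology (Fin 3 → Fin 3 → ℂ))

instance : SecondCountableTopology SU21 :=
  (SpecialLinearGroup.isClosedEmbedding_val.isEmbedding.comp
    (IsEmbedding.subtypeVal (p := (· ∈ SU21)))).secondCountableTopology

instance (Γ : Subgroup SU21) [DiscreteTopology Γ] : Countable Γ :=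
  TopologicalSpace.separableSpace_iff_countable.1 inferInstance

lemma isClosed_SU21 : IsClosed (SU21 : Set (SpecialLinearGroup (Fin 3) ℂ)) :=
  isClosed_singleton.preimage (by fun_prop : Continuous fun A : SpecialLinearGroup (Fin 3) ℂ =>
    (A : Matrix (Fin 3) (Fin 3) ℂ)ᴴ * H * (A : Matrix (Fin 3) (Fin 3) ℂ))

lemma isCompact_setOf_norm_mat_le (C : ℝ) : IsCompact {g : SU21 | ∀ i j, ‖mat g i j‖ ≤ C} := by
  have hbox : IsCompact (Set.univ.pi fun _ : Fin 3 => Set.univ.pi fun _ : Fin 3 =>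
      Metric.closedBall (0 : ℂ) C) :=
    isCompact_univ_pi fun _ => isCompact_univ_pi fun _ => isCompact_closedBall _ _
  refine (congrArg IsCompact (Set.ext fun g => ?_)).mpr
    ((SpecialLinearGroup.isClosedEmbedding_val.comp
      isClosed_SU21.isClosedEmbedding_subtypeVal).isCompact_preimage hbox)
  exact ⟨fun h i _ j _ => mem_closedBall_zero_iff.2 (h i j),
    fun h i j => mem_closedBall_zero_iff.1 (h i trivial j trivial)⟩

variable (Γ : Subgroup SU21)

theorem finite_setOf_smul_mem [DiscreteTopology Γ] {r : ℝ} (hr : r < 1) :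
    {γ : Γ | ∃ x : Ball2, ‖x.1‖ ≤ r ∧ ‖(γ • x).1‖ ≤ r}.Finite := by
  set D := 1 / ((1 - r) ^ 2 * (1 - r ^ 2))
  have hemb : IsClosedEmbedding (Subtype.val : Γ → SU21) :=
    (Subgroup.isClosed_of_discrete (H := Γ)).isClosedEmbedding_subtypeVal
  refine (hemb.isCompact_preimage
    (isCompact_setOf_norm_mat_le √(1 + D))).finite_of_discrete.subset ?_
  rintro γ ⟨x, hx, hγx⟩ i j
  have hr0 : 0 ≤ r := (norm_nonneg _).trans hx
  have hpos : 0 < (1 - r) ^ 2 * (1 - r ^ 2) :=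
    mul_pos (pow_pos (sub_pos.2 hr) 2) (sub_pos.2 (pow_lt_one₀ hr0 hr two_ne_zero))
  refine Real.le_sqrt_of_sq_le ((norm_mat_apply_sq_le γ.1 i j).trans ?_)
  gcongr
  exact (le_div_iff₀ hpos).2 (norm_mat_sq_mul_le hr hx hγx)

lemma exists_tsum_indicator_le [DiscreteTopology Γ] {r : ℝ} (hr : r < 1) :
    ∃ N : ℕ, ∀ y : Ball2,
      ∑' γ : Γ, ({x : Ball2 | ‖x.1‖ ≤ r}.indicator 1 (γ • y) : ENNReal) ≤ N := by
  set S := {x : Ball2 | ‖x.1‖ ≤ r}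
  have hfin := finite_setOf_smul_mem Γ hr
  refine ⟨hfin.toFinset.card, fun y => ?_⟩
  by_cases hy : ∃ γ₀ : Γ, γ₀ • y ∈ S
  · obtain ⟨γ₀, h₀⟩ := hy
    rw [← (Equiv.mulRight γ₀).tsum_eq, tsum_eq_sum (s := hfin.toFinset)]
    · refine (Finset.sum_le_sum (g := fun _ => 1) fun γ _ => ?_).trans_eq (by simp)
      exact Set.indicator_le_self' (fun _ _ => zero_le) _
    · intro γ hγ
      refine Set.indicator_of_notMem (fun hmem => hγ (hfin.mem_toFinset.2 ⟨γ₀ • y, h₀, ?_⟩)) _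
      rwa [Equiv.coe_mulRight, mul_smul] at hmem
  · push Not at hy
    simp [Set.indicator_of_notMem (hy _)]

lemma isOfFinOrder_of_smul_eq [DiscreteTopology Γ] {γ : SU21} (hγ : γ ∈ Γ) {z : Ball2}
    (h : γ • z = z) : IsOfFinOrder γ := by
  lift γ to Γ using hγ
  refine Γ.subtype.isOfFinOrder (x := γ) ?_
  by_contra hinf
  refine Set.infinite_range_of_injective (injective_pow_iff_not_isOfFinOrder.2 hinf)
    ((finite_setOf_smul_mem Γ (mem_ball_zero_iff.1 z.2)).subset ?_)
  rintro _ ⟨n, rfl⟩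
  have hpow : γ ^ n • z = z := (MulAction.stabilizer Γ z).pow_mem h n
  exact ⟨z, le_rfl, (congrArg (‖·.1‖) hpow).le⟩

lemma exists_smul_norm_le [CompactSpace (PicardSurface Γ)] :
    ∃ r : ℝ, r < 1 ∧ ∀ x : Ball2, ∃ γ : Γ, ‖(γ • x).1‖ ≤ r := by
  let π : Ball2 → PicardSurface Γ := Quotient.mk _
  have hπ : IsOpenMap π := isOpenMap_quotient_mk'_mul
  let U : ℕ → Set (PicardSurface Γ) := fun n => π '' {x | ‖x.1‖ < 1 - 1 / ((n : ℝ) + 1)}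
  have hcover : Set.univ ⊆ ⋃ n, U n := fun q _ => by
    induction q using Quotient.inductionOn with
    | h x =>
      obtain ⟨n, hn⟩ := exists_nat_one_div_lt (sub_pos.2 (mem_ball_zero_iff.1 x.2))
      exact Set.mem_iUnion.2 ⟨n, x, lt_sub_comm.1 hn, rfl⟩
  have hmono : Monotone U := fun m n hmn => Set.image_mono fun x (hx : ‖x.1‖ < _) =>
    hx.trans_le (by gcongr)
  obtain ⟨n, hn⟩ := isCompact_univ.elim_directed_cover U
    (fun n => hπ _ (isOpen_lt (by fun_prop) continuous_const)) hcover hmono.directed_le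
  refine ⟨1 - 1 / ((n : ℝ) + 1), sub_lt_self _ (by positivity), fun x => ?_⟩
  obtain ⟨y, hy, hyx⟩ := hn (Set.mem_univ (π x))
  obtain ⟨γ, hγ⟩ := Quotient.exact hyx
  exact ⟨γ, (show γ • x = y from hγ) ▸ (le_of_lt hy : ‖y.1‖ ≤ _)⟩

end ProperlyDiscontinuous

section Poincare

lemma norm_jacobian_inv_le (g : SU21) (y : Ball2) : ‖jacobian g⁻¹ y‖ ≤ 8 * ‖mat g 2 2‖ ^ 3 := by
  have hone := one_le_two_mul_norm_mat_mul_norm_den g⁻¹ y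
  rw [norm_mat_inv_apply] at hone
  have hden := norm_den_pos g⁻¹ y
  rw [jacobian_eq, norm_inv, norm_pow, inv_le_iff_one_le_mul₀ (by positivity)]
  calc (1 : ℝ) ≤ (2 * ‖mat g 2 2‖ * ‖den g⁻¹ y.1‖) ^ 3 := one_le_pow₀ hone
    _ = 8 * ‖mat g 2 2‖ ^ 3 * ‖den g⁻¹ y.1‖ ^ 3 := by ring

lemma norm_jacobian_inv_mul_le (g h : SU21) (y : Ball2) :
    ‖jacobian (g⁻¹ * h) y‖ ≤ 8 * ‖mat g 2 2‖ ^ 3 * ‖jacobian h y‖ := by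
  rw [jacobian_mul, norm_mul]
  gcongr
  exact norm_jacobian_inv_le g _

lemma norm_jacobian_origin_mul (g : SU21) : ‖jacobian g origin‖ * ‖mat g 2 2‖ ^ 3 = 1 := by
  have hden : den g origin.1 = mat g 2 2 := by simp [den_eq, origin]
  have hpos := one_le_norm_mat g
  rw [jacobian_eq, hden, norm_inv, norm_pow, inv_mul_cancel₀ (by positivity)]

lemma norm_jacobian_conj_le (g h : SU21) :
    ‖jacobian (g⁻¹ * h * g) origin‖ ≤ 8 * ‖jacobian h (g • origin)‖ := by
  rw [jacobian_mul, norm_mul]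
  refine (mul_le_mul_of_nonneg_right (norm_jacobian_inv_mul_le g h _) (norm_nonneg _)).trans_eq ?_
  linear_combination 8 * ‖jacobian h (g • origin)‖ * norm_jacobian_origin_mul g

lemma norm_jacobian_origin_sq (g : SU21) : ‖jacobian g origin‖ ^ 2 = weight (g • origin) ^ 3 := by
  rw [weight_smul_pow_three, weight_origin, one_pow, one_mul]

lemma norm_jacobian_origin_le_one (g : SU21) : ‖jacobian g origin‖ ≤ 1 := by
  rw [← sq_le_one_iff₀ (norm_nonneg _), norm_jacobian_origin_sq]
  exact pow_le_one₀ (weight_pos _).le (weight_le_one _)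

lemma norm_jacobian_origin_lt_one {g : SU21} (hg : g • origin ≠ origin) :
    ‖jacobian g origin‖ < 1 := by
  rw [← sq_lt_one_iff₀ (norm_nonneg _), norm_jacobian_origin_sq]
  refine pow_lt_one₀ (weight_pos _).le (sub_lt_self _ ?_) three_ne_zero
  have hne : (g • origin).1 ≠ 0 := fun h => hg (Subtype.ext h)
  positivity

lemma enorm_sq_mul_volume_ball_le {h : Ball2 → ℂ} (hh : IsHolomorphic h) {x : Ball2} {δ r : ℝ}
    (hxr : ‖x.1‖ + δ ≤ r) (hr : r < 1) :
    ‖h x‖ₑ ^ 2 * volume (Metric.ball (0 : E) δ) ≤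
      ∫⁻ z in {y : Ball2 | ‖y.1‖ ≤ r}, ‖h z‖ₑ ^ 2 ∂eucMeasure := by
  have hsub : ∀ u ∈ Metric.ball x.1 δ, ‖u‖ ≤ r := fun u hu => by
    linarith [norm_sub_norm_le u x.1, mem_ball_iff_norm.1 hu]
  have hsub1 : Metric.ball x.1 δ ⊆ Metric.ball 0 1 := fun u hu =>
    mem_ball_zero_iff.2 ((hsub u hu).trans_lt hr)
  have hmean := enorm_mul_volume_ball_le ((hh.mono hsub1).pow 2)
  simp only [Pi.pow_apply, enorm_pow, extendZero_apply _ x.2] at hmean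
  calc ‖h x‖ₑ ^ 2 * volume (Metric.ball (0 : E) δ)
      ≤ ∫⁻ u in Metric.ball x.1 δ, ‖extendZero h u‖ₑ ^ 2 := hmean
    _ ≤ ∫⁻ u in Subtype.val '' {y : Ball2 | ‖y.1‖ ≤ r}, ‖extendZero h u‖ₑ ^ 2 :=
        lintegral_mono_set fun u hu => ⟨⟨u, hsub1 hu⟩, hsub u hu, rfl⟩
    _ = ∫⁻ z in {y : Ball2 | ‖y.1‖ ≤ r}, ‖extendZero h z.1‖ₑ ^ 2 ∂eucMeasure :=
        (setLIntegral_subtype measurableSet_ball _ _).symm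
    _ = ∫⁻ z in {y : Ball2 | ‖y.1‖ ≤ r}, ‖h z‖ₑ ^ 2 ∂eucMeasure := by
        simp only [extendZero_apply _ (Subtype.prop _), Subtype.coe_eta]

lemma measurableSet_norm_le (r : ℝ) : MeasurableSet {x : Ball2 | ‖x.1‖ ≤ r} :=
  (isClosed_le (by fun_prop) continuous_const).measurableSet

variable (Γ : Subgroup SU21)

-- By the change of variables formula the sum is the integral of the number of points of an orbit
-- in a compact set.
lemma tsum_lintegral_enorm_jacobian_sq_ne_top [DiscreteTopology Γ] {r : ℝ} (hr : r < 1) :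
    ∑' γ : Γ, ∫⁻ x in {y : Ball2 | ‖y.1‖ ≤ r}, ‖jacobian (γ : SU21) x‖ₑ ^ 2 ∂eucMeasure ≠ ⊤ := by
  set S := {y : Ball2 | ‖y.1‖ ≤ r}
  have hS : MeasurableSet S := measurableSet_norm_le r
  obtain ⟨N, hN⟩ := exists_tsum_indicator_le Γ hr
  have hterm (γ : Γ) : ∫⁻ x in S, ‖jacobian (γ : SU21) x‖ₑ ^ 2 ∂eucMeasure =
      ∫⁻ x : Ball2, S.indicator 1 (γ⁻¹ • x) ∂eucMeasure := by
    rw [← lintegral_enorm_jacobian_sq_mul (γ : SU21), ← lintegral_indicator hS]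
    refine lintegral_congr fun x => ?_
    rw [show (γ : SU21) • x = γ • x from rfl, inv_smul_smul]
    by_cases hx : x ∈ S <;> simp [hx]
  have hmeas (γ : Γ) : Measurable fun x : Ball2 => (S.indicator 1 (γ • x) : ENNReal) :=
    (measurable_one.indicator hS).comp (measurable_const_smul γ)
  have hle : ∑' γ : Γ, ∫⁻ x : Ball2, S.indicator 1 (γ • x) ∂eucMeasure ≤
      ∫⁻ _ : Ball2, N ∂eucMeasure := by
    rw [← lintegral_tsum fun γ => (hmeas γ).aemeasurable]
    exact lintegral_mono hN
  simp only [hterm]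
  rw [← (Equiv.inv Γ).tsum_eq]
  simp only [Equiv.inv_apply, inv_inv]
  refine ne_top_of_le_ne_top ?_ hle
  rw [lintegral_const]
  exact ENNReal.mul_ne_top (ENNReal.natCast_ne_top N) (measure_ne_top _ _)

lemma exists_summable_norm_jacobian_sq_le [DiscreteTopology Γ] {r : ℝ} (hr : r < 1) :
    ∃ u : Γ → ℝ, Summable u ∧
      ∀ (γ : Γ) (x : Ball2), ‖x.1‖ ≤ r → ‖jacobian (γ : SU21) x‖ ^ 2 ≤ u γ := by
  set δ := (1 - r) / 2 with hδ
  have hδ0 : 0 < δ := by rw [hδ]; linarith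
  have hrδ : r + δ < 1 := by rw [hδ]; linarith
  set V := volume (Metric.ball (0 : E) δ)
  have hV0 : V ≠ 0 := (Metric.measure_ball_pos volume _ hδ0).ne'
  have hVtop : V ≠ ⊤ := measure_ball_lt_top.ne
  set I : Γ → ENNReal := fun γ =>
    ∫⁻ x in {y : Ball2 | ‖y.1‖ ≤ r + δ}, ‖jacobian (γ : SU21) x‖ₑ ^ 2 ∂eucMeasure
  have hsum : ∑' γ, I γ / V ≠ ⊤ := by
    simp only [div_eq_mul_inv]
    rw [ENNReal.tsum_mul_right]
    exact ENNReal.mul_ne_top (tsum_lintegral_enorm_jacobian_sq_ne_top Γ hrδ)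
      (ENNReal.inv_ne_top.2 hV0)
  refine ⟨fun γ => (I γ / V).toReal, ENNReal.summable_toReal hsum, fun γ x hx => ?_⟩
  have hle : ‖jacobian (γ : SU21) x‖ₑ ^ 2 ≤ I γ / V :=
    (ENNReal.le_div_iff_mul_le (Or.inl hV0) (Or.inl hVtop)).2
      (enorm_sq_mul_volume_ball_le (isHolomorphic_jacobian γ) (by gcongr) hrδ)
  simpa using ENNReal.toReal_mono (ENNReal.ne_top_of_tsum_ne_top hsum γ) hle

/-- The Poincaré series of weight `k` attached to an element `g` of `SU((2,1), ℂ)`, an average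
over `Γ` of the section `(g⁻¹)^* (dz₁ ∧ dz₂)^{⊗k}`. -/
def poincareSeries (g : SU21) (k : ℕ) (w : Ball2) : ℂ :=
  ∑' γ : Γ, jacobian (g⁻¹ * γ) w ^ k

lemma exists_summable_norm_jacobian_pow_le [DiscreteTopology Γ] (g : SU21) {k : ℕ} (hk : 2 ≤ k)
    {r : ℝ} (hr : r < 1) : ∃ u : Γ → ℝ, Summable u ∧
      ∀ (γ : Γ) (x : Ball2), ‖x.1‖ ≤ r → ‖jacobian (g⁻¹ * γ) x ^ k‖ ≤ u γ := by
  obtain ⟨u, hu, hle⟩ := exists_summable_norm_jacobian_sq_le Γ hr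
  set C := 8 * ‖mat g 2 2‖ ^ 3
  set M := √(∑' γ, u γ)
  refine ⟨fun γ => C ^ k * M ^ (k - 2) * u γ, hu.mul_left _, fun γ x hx => ?_⟩
  have hM : ‖jacobian (γ : SU21) x‖ ≤ M := Real.le_sqrt_of_sq_le ((hle γ x hx).trans
    (hu.le_tsum γ fun γ' _ => (sq_nonneg _).trans (hle γ' x hx)))
  rw [norm_pow]
  calc ‖jacobian (g⁻¹ * γ) x‖ ^ k ≤ (C * ‖jacobian (γ : SU21) x‖) ^ k := by
        gcongr
        exact norm_jacobian_inv_mul_le g γ x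
    _ = C ^ k * ‖jacobian (γ : SU21) x‖ ^ (k - 2) * ‖jacobian (γ : SU21) x‖ ^ 2 := by
        rw [mul_pow, mul_assoc, ← pow_add, Nat.sub_add_cancel hk]
    _ ≤ C ^ k * M ^ (k - 2) * u γ := by
        gcongr
        exact hle γ x hx

theorem isHolomorphic_poincareSeries [DiscreteTopology Γ] (g : SU21) {k : ℕ} (hk : 2 ≤ k) :
    IsHolomorphic (poincareSeries Γ g k) := by
  intro z hz
  obtain ⟨r, hzr, hr⟩ := exists_between (mem_ball_zero_iff.1 hz)
  have hsub : Metric.ball (0 : E) r ⊆ Metric.ball 0 1 := Metric.ball_subset_ball hr.le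
  obtain ⟨u, hu, hle⟩ := exists_summable_norm_jacobian_pow_le Γ g hk hr
  have hdiff := differentiableOn_tsum_of_summable_of_norm_le Metric.isOpen_ball hu
    (f := fun γ : Γ => extendZero (jacobian (g⁻¹ * γ)) ^ k)
    (fun γ => ((isHolomorphic_jacobian (g⁻¹ * γ)).mono hsub).pow k) fun γ x hx => by
      simpa only [Pi.pow_apply, extendZero_apply _ (hsub hx)] using
        hle γ ⟨x, hsub hx⟩ (mem_ball_zero_iff.1 hx).le
  have hzr' : Metric.ball (0 : E) r ∈ 𝓝 z :=
    Metric.isOpen_ball.mem_nhds (mem_ball_zero_iff.2 hzr)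
  refine ((hdiff.differentiableAt hzr').congr_of_eventuallyEq ?_).differentiableWithinAt
  filter_upwards [hzr'] with x hx
  simp only [Pi.pow_apply, extendZero_apply _ (hsub hx), poincareSeries]

lemma poincareSeries_smul_mul_jacobian (g : SU21) (k : ℕ) (γ : Γ) (z : Ball2) :
    poincareSeries Γ g k (γ • z) * jacobian γ z ^ k = poincareSeries Γ g k z := by
  rw [poincareSeries, poincareSeries, ← tsum_mul_right,
    ← (Equiv.mulRight γ).tsum_eq fun γ' : Γ => jacobian (g⁻¹ * γ') z ^ k]
  refine tsum_congr fun γ' => ?_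
  rw [Equiv.coe_mulRight, Subgroup.coe_mul, ← mul_assoc, jacobian_mul _ (γ : SU21), mul_pow]
  rfl

theorem poincareSeries_mem [DiscreteTopology Γ] (g : SU21) {k : ℕ} (hk : 2 ≤ k) :
    poincareSeries Γ g k ∈ H0 Γ k :=
  ⟨isHolomorphic_poincareSeries Γ g hk,
    fun γ hγ z => poincareSeries_smul_mul_jacobian Γ g k ⟨γ, hγ⟩ z⟩

end Poincare

section Orthonormal

variable {𝕜 V : Type*} [RCLike 𝕜] [NormedAddCommGroup V] [InnerProductSpace 𝕜 V]

theorem finiteDimensional_of_orthonormal_card_le (n : ℕ)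
    (h : ∀ (m : ℕ) (v : Fin m → V), Orthonormal 𝕜 v → m ≤ n) : FiniteDimensional 𝕜 V := by
  have hrank : Module.rank 𝕜 V ≤ n := rank_le fun s hs => by
    have hcard : Module.finrank 𝕜 (Submodule.span 𝕜 (s : Set V)) = s.card :=
      finrank_span_set_eq_card hs |>.trans (by simp)
    rw [← hcard]
    exact h _ _ ((stdOrthonormalBasis 𝕜 (Submodule.span 𝕜 (s : Set V))).orthonormal
      |>.comp_linearIsometry (Submodule.span 𝕜 (s : Set V)).subtypeₗᵢ)
  exact Module.rank_lt_aleph0_iff.1 (hrank.trans_lt Cardinal.natCast_lt_aleph0)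

theorem sum_norm_apply_sq_le_of_orthonormal {ι : Type*} [Fintype ι] {φ : V →ₗ[𝕜] 𝕜} {C : ℝ}
    (hφ : ∀ f, ‖φ f‖ ^ 2 ≤ C * ‖f‖ ^ 2) (hC : 0 ≤ C) {v : ι → V} (hv : Orthonormal 𝕜 v) :
    ∑ i, ‖φ (v i)‖ ^ 2 ≤ C := by
  set T := ∑ i, ‖φ (v i)‖ ^ 2
  have hT : 0 ≤ T := Finset.sum_nonneg fun i _ => sq_nonneg _
  set f := ∑ i, starRingEnd 𝕜 (φ (v i)) • v i
  have hφf : φ f = (T : 𝕜) := by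
    simp only [f, T, map_sum, map_smul, smul_eq_mul, RCLike.conj_mul, RCLike.ofReal_pow]
  have hf : ‖f‖ ^ 2 = T := by
    have hinner : (inner 𝕜 f f : 𝕜) = (T : 𝕜) := by
      simp only [f, T, hv.inner_sum, RCLike.conj_conj, RCLike.mul_conj, RCLike.ofReal_sum,
        RCLike.ofReal_pow]
    rw [inner_self_eq_norm_sq_to_K] at hinner
    exact_mod_cast hinner
  have hle := hφ f
  rw [hφf, hf, RCLike.norm_ofReal, sq_abs, sq] at hle
  rcases hT.eq_or_lt with h | h
  · rwa [← h]
  · exact le_of_mul_le_mul_right hle h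

end Orthonormal

section Unfolding

variable {G α W : Type*} [Group G] [Countable G] [MulAction G α] [MeasurableSpace α]
  [MeasurableConstSMul G α] [NormedAddCommGroup W] [NormedSpace ℝ W] {μ : Measure α}
  [SMulInvariantMeasure G α μ] {F : Set α}

theorem lintegral_eq_setLIntegral_tsum_smul (hF : IsFundamentalDomain G F μ) {φ : α → ENNReal}
    (hφ : Measurable φ) : ∫⁻ z, φ z ∂μ = ∫⁻ z in F, ∑' g : G, φ (g • z) ∂μ := by
  have hmeas (g : G) : Measurable fun z => φ (g • z) := hφ.comp (measurable_const_smul g)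
  rw [hF.lintegral_eq_tsum'', lintegral_tsum fun g => (hmeas g).aemeasurable]

theorem integral_eq_setIntegral_tsum_smul (hF : IsFundamentalDomain G F μ) {φ : α → W}
    (hφ : Integrable φ μ) : ∫ z, φ z ∂μ = ∫ z in F, ∑' g : G, φ (g • z) ∂μ := by
  have hint (g : G) : Integrable (fun z => φ (g • z)) (μ.restrict F) :=
    ((measurePreserving_smul g μ).integrable_comp_of_integrable hφ).restrict
  have hfin : ∑' g : G, ∫⁻ z in F, ‖φ (g • z)‖ₑ ∂μ ≠ ⊤ := by
    rw [← hF.lintegral_eq_tsum'' fun z => ‖φ z‖ₑ]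
    exact hφ.2.ne
  have hsum : Summable fun g : G => ∫ z in F, ‖φ (g • z)‖ ∂μ :=
    (ENNReal.summable_toReal hfin).congr fun g =>
      (integral_norm_eq_lintegral_enorm (hint g).aestronglyMeasurable).symm
  rw [hF.integral_eq_tsum'' φ hφ,
    (hasSum_integral_of_summable_integral_norm hint hsum).tsum_eq]

end Unfolding

section Sections

/-- The pull-back `g^*(f (dz₁ ∧ dz₂)^{⊗k})`, represented by its coefficient. -/
def pullback (k : ℕ) (g : SU21) (f : Ball2 → ℂ) (z : Ball2) : ℂ := f (g • z) * jacobian g z ^ k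

/-- The point-wise Hermitian inner product of the forms `f (dz₁ ∧ dz₂)^{⊗k}` and
`h (dz₁ ∧ dz₂)^{⊗k}`, the integrand of `innerHyp`. -/
def pairing (k : ℕ) (f h : Ball2 → ℂ) (z : Ball2) : ℂ :=
  ((weight z ^ (3 * k) : ℝ) : ℂ) * f z * starRingEnd ℂ (h z)

/-- The square `|f (dz₁ ∧ dz₂)^{⊗k}|²_hyp` of the point-wise norm. -/
def normSq (k : ℕ) (f : Ball2 → ℂ) (z : Ball2) : ℝ := weight z ^ (3 * k) * ‖f z‖ ^ 2

variable {Γ : Subgroup SU21} {F : Set Ball2} {k : ℕ} {f h : Ball2 → ℂ}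

lemma normSq_nonneg (k : ℕ) (f : Ball2 → ℂ) (z : Ball2) : 0 ≤ normSq k f z :=
  mul_nonneg (pow_nonneg (weight_pos z).le _) (sq_nonneg _)

lemma pairing_self (k : ℕ) (f : Ball2 → ℂ) (z : Ball2) : pairing k f f z = normSq k f z := by
  rw [pairing, normSq, mul_assoc, Complex.mul_conj, Complex.normSq_eq_norm_sq, Complex.ofReal_mul]

lemma conj_pairing (k : ℕ) (f h : Ball2 → ℂ) (z : Ball2) :
    starRingEnd ℂ (pairing k f h z) = pairing k h f z := by
  simp only [pairing, map_mul, Complex.conj_ofReal, Complex.conj_conj]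
  ring

lemma norm_pairing_le (k : ℕ) (f h : Ball2 → ℂ) (z : Ball2) :
    ‖pairing k f h z‖ ≤ (normSq k f z + normSq k h z) / 2 := by
  have hw : 0 ≤ weight z ^ (3 * k) := pow_nonneg (weight_pos z).le _
  rw [pairing, norm_mul, norm_mul, RCLike.norm_conj, Complex.norm_real, Real.norm_of_nonneg hw,
    normSq, normSq]
  linarith [mul_nonneg hw (sq_nonneg (‖f z‖ - ‖h z‖))]

lemma pairing_pullback (k : ℕ) (g : SU21) (f h : Ball2 → ℂ) (z : Ball2) :
    pairing k (pullback k g f) (pullback k g h) z = pairing k f h (g • z) := by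
  have hw : weight (g • z) ^ (3 * k) = weight z ^ (3 * k) * (‖jacobian g z‖ ^ 2) ^ k := by
    rw [pow_mul, weight_smul_pow_three, mul_pow, ← pow_mul]
  rw [pairing, pairing, hw, ← Complex.normSq_eq_norm_sq]
  push_cast
  rw [← Complex.mul_conj, pullback, pullback, map_mul, map_pow]
  ring

lemma normSq_pullback (k : ℕ) (g : SU21) (f : Ball2 → ℂ) (z : Ball2) :
    normSq k (pullback k g f) z = normSq k f (g • z) := by
  have h := pairing_pullback k g f f z
  rw [pairing_self, pairing_self] at h
  exact_mod_cast h

lemma continuous_pairing (hf : Continuous f) (hh : Continuous h) : Continuous (pairing k f h) :=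
  ((Complex.continuous_ofReal.comp (continuous_weight.pow _)).mul hf).mul
    (Complex.continuous_conj.comp hh)

lemma continuous_normSq (hf : Continuous f) : Continuous (normSq k f) :=
  (continuous_weight.pow _).mul (hf.norm.pow 2)

lemma isHolomorphic_pullback (k : ℕ) (g : SU21) (hf : IsHolomorphic f) :
    IsHolomorphic (pullback k g f) := by
  have hcomp : DifferentiableOn ℂ (extendZero f ∘ moebius (mat g)) (Metric.ball 0 1) :=
    hf.comp (fun x hx => (differentiableAt_moebius g hx).differentiableWithinAt)
      fun x hx => moebius_mem_ball g ⟨x, hx⟩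
  refine (hcomp.mul ((isHolomorphic_jacobian g).pow k)).congr fun x hx => ?_
  simp only [Pi.mul_apply, Pi.pow_apply, Function.comp_apply, extendZero_apply _ hx,
    extendZero_apply _ (moebius_mem_ball g ⟨x, hx⟩)]
  rfl

lemma continuous_of_mem (hf : f ∈ H0 Γ k) : Continuous f := IsHolomorphic.continuous hf.1

lemma pullback_of_mem (hf : f ∈ H0 Γ k) (γ : Γ) : pullback k γ f = f :=
  funext (hf.2 γ γ.2)

lemma normSq_smul (hf : f ∈ H0 Γ k) (γ : Γ) (z : Ball2) : normSq k f (γ • z) = normSq k f z := by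
  rw [show γ • z = (γ : SU21) • z from rfl, ← normSq_pullback, pullback_of_mem hf]

end Sections

section Finiteness

variable {Γ : Subgroup SU21} {F : Set Ball2} {k : ℕ} {f h : Ball2 → ℂ}

lemma isCompact_norm_le {r : ℝ} (hr : r < 1) : IsCompact {x : Ball2 | ‖x.1‖ ≤ r} := by
  have hset : {x : Ball2 | ‖x.1‖ ≤ r} = Subtype.val ⁻¹' Metric.closedBall (0 : E) r := by
    ext x
    simp
  rw [hset, IsInducing.subtypeVal.isCompact_preimage_iff]
  · exact isCompact_closedBall _ _
  · rw [Subtype.range_coe]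
    exact Metric.closedBall_subset_ball hr

lemma exists_normSq_le [CompactSpace (PicardSurface Γ)] (hf : f ∈ H0 Γ k) :
    ∃ M, ∀ z, normSq k f z ≤ M := by
  obtain ⟨r, hr, hmove⟩ := exists_smul_norm_le Γ
  obtain ⟨M, hM⟩ := (isCompact_norm_le hr).exists_bound_of_continuousOn
    (continuous_normSq (k := k) (continuous_of_mem hf)).continuousOn
  refine ⟨M, fun z => ?_⟩
  obtain ⟨γ, hγ⟩ := hmove z
  rw [← normSq_smul hf γ]
  exact (le_abs_self _).trans (hM _ hγ)

instance : IsLocallyFiniteMeasure hypMeasure := by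
  have : Continuous fun z : Ball2 => (weight z ^ 3)⁻¹ :=
    (continuous_weight.pow 3).inv₀ fun z => (pow_pos (weight_pos z) 3).ne'
  rw [hypMeasure_eq_withDensity]
  exact IsLocallyFiniteMeasure.withDensity_ofReal this

lemma eucMeasure_le_hypMeasure : eucMeasure ≤ hypMeasure := by
  refine Measure.le_iff.2 fun s hs => ?_
  rw [hypMeasure_eq_withDensity, withDensity_apply _ hs, ← setLIntegral_one]
  refine lintegral_mono fun z => ENNReal.one_le_ofReal.2 ?_
  exact (one_le_inv₀ (pow_pos (weight_pos z) 3)).2 (pow_le_one₀ (weight_pos z).le (weight_le_one z))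

lemma one_sub_sq_le_weight {r : ℝ} {z : Ball2} (hz : ‖z.1‖ ≤ r) : 1 - r ^ 2 ≤ weight z :=
  sub_le_sub_left (pow_le_pow_left₀ (norm_nonneg _) hz 2) 1

lemma setLIntegral_enorm_sq_le (k : ℕ) (f : Ball2 → ℂ) {r : ℝ} (hr : r < 1) :
    ∫⁻ z in {x : Ball2 | ‖x.1‖ ≤ r}, ‖f z‖ₑ ^ 2 ∂eucMeasure ≤
      ENNReal.ofReal ((1 - r ^ 2) ^ (3 * k))⁻¹ *
        ∫⁻ z in {x : Ball2 | ‖x.1‖ ≤ r}, ENNReal.ofReal (normSq k f z) ∂hypMeasure := by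
  refine (lintegral_mono' (Measure.restrict_mono le_rfl eucMeasure_le_hypMeasure) le_rfl).trans ?_
  rw [← lintegral_const_mul' _ _ ENNReal.ofReal_ne_top]
  refine setLIntegral_mono' (measurableSet_norm_le r) fun z hz => ?_
  have hr0 : 0 ≤ r := (norm_nonneg z.1).trans hz
  have hc : 0 < (1 - r ^ 2) ^ (3 * k) := pow_pos (by nlinarith) _
  rw [← ofReal_norm, ← ENNReal.ofReal_pow (norm_nonneg _), ← ENNReal.ofReal_mul (by positivity)]
  refine ENNReal.ofReal_le_ofReal ((le_inv_mul_iff₀ hc).2 ?_)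
  rw [normSq]
  gcongr
  · nlinarith
  · exact one_sub_sq_le_weight hz

lemma measurable_indicator_norm_le (r : ℝ) :
    Measurable ({x : Ball2 | ‖x.1‖ ≤ r}.indicator 1 : Ball2 → ENNReal) :=
  measurable_one.indicator (measurableSet_norm_le r)

variable [DiscreteTopology Γ]

lemma hypMeasure_fundamentalDomain_ne_top [CompactSpace (PicardSurface Γ)]
    (hF : IsFundamentalDomain Γ F hypMeasure) : hypMeasure F ≠ ⊤ := by
  obtain ⟨r, hr, hmove⟩ := exists_smul_norm_le Γ
  set S := {x : Ball2 | ‖x.1‖ ≤ r}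
  have hone (z : Ball2) : 1 ≤ ∑' γ : Γ, (S.indicator 1 (γ • z) : ENNReal) := by
    obtain ⟨γ, hγ⟩ := hmove z
    refine le_trans ?_ (ENNReal.le_tsum γ)
    rw [Set.indicator_of_mem (show γ • z ∈ S from hγ), Pi.one_apply]
  refine ne_top_of_le_ne_top ((isCompact_norm_le hr).measure_lt_top (μ := hypMeasure)).ne ?_
  calc hypMeasure F = ∫⁻ _ in F, 1 ∂hypMeasure := (setLIntegral_one F).symm
    _ ≤ ∫⁻ z in F, ∑' γ : Γ, S.indicator 1 (γ • z) ∂hypMeasure := lintegral_mono hone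
    _ = ∫⁻ z, S.indicator 1 z ∂hypMeasure :=
        (lintegral_eq_setLIntegral_tsum_smul hF (measurable_indicator_norm_le r)).symm
    _ = hypMeasure S := lintegral_indicator_one (measurableSet_norm_le r)

lemma exists_setLIntegral_norm_le_le (hF : IsFundamentalDomain Γ F hypMeasure) {r : ℝ}
    (hr : r < 1) : ∃ N : ℕ, ∀ φ : Ball2 → ENNReal, Measurable φ →
      (∀ (γ : Γ) (z : Ball2), φ (γ • z) = φ z) →
      ∫⁻ z in {x : Ball2 | ‖x.1‖ ≤ r}, φ z ∂hypMeasure ≤ N * ∫⁻ z in F, φ z ∂hypMeasure := by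
  obtain ⟨N, hN⟩ := exists_tsum_indicator_le Γ hr
  refine ⟨N, fun φ hφ hinv => ?_⟩
  set S := {x : Ball2 | ‖x.1‖ ≤ r}
  have hmul (γ : Γ) (z : Ball2) : S.indicator φ (γ • z) = S.indicator 1 (γ • z) * φ z := by
    rw [← hinv γ z]
    by_cases hz : γ • z ∈ S <;> simp [hz]
  rw [← lintegral_indicator (measurableSet_norm_le r), lintegral_eq_setLIntegral_tsum_smul hF
    (hφ.indicator (measurableSet_norm_le r)), ← lintegral_const_mul _ hφ]
  refine lintegral_mono fun z => ?_
  simp only [S] at hmul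
  simp only [hmul, ENNReal.tsum_mul_right]
  exact mul_le_mul_left (hN z) _

variable [CompactSpace (PicardSurface Γ)]

lemma integrableOn_pairing (hF : IsFundamentalDomain Γ F hypMeasure) (hf : f ∈ H0 Γ k)
    (hh : h ∈ H0 Γ k) : IntegrableOn (pairing k f h) F hypMeasure := by
  obtain ⟨M, hM⟩ := exists_normSq_le hf
  obtain ⟨M', hM'⟩ := exists_normSq_le hh
  refine Measure.integrableOn_of_bounded (hypMeasure_fundamentalDomain_ne_top hF)
    (continuous_pairing (continuous_of_mem hf) (continuous_of_mem hh)).aestronglyMeasurable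
    (M := (M + M') / 2) (Eventually.of_forall fun z => (norm_pairing_le k f h z).trans ?_)
  gcongr
  exacts [hM z, hM' z]

lemma integrableOn_normSq (hF : IsFundamentalDomain Γ F hypMeasure) (hf : f ∈ H0 Γ k) :
    IntegrableOn (normSq k f) F hypMeasure :=
  (integrableOn_pairing hF hf hf).re.congr
    (Eventually.of_forall fun z => by simp [pairing_self])

-- Move the point into a fixed compact ball; there the sub-mean value property bounds `f` by its
-- `L²` norm over a slightly larger ball, which meets boundedly many translates of `F`.
theorem exists_normSq_le_mul_setIntegral (hF : IsFundamentalDomain Γ F hypMeasure) (k : ℕ) :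
    ∃ C : ℝ, 0 ≤ C ∧ ∀ f ∈ H0 Γ k, ∀ z,
      normSq k f z ≤ C * ∫ w in F, normSq k f w ∂hypMeasure := by
  obtain ⟨r, hr, hmove⟩ := exists_smul_norm_le Γ
  set δ := (1 - r) / 2 with hδ
  have hδ0 : 0 < δ := by rw [hδ]; linarith
  have hrδ : r + δ < 1 := by rw [hδ]; linarith
  obtain ⟨N, hN⟩ := exists_setLIntegral_norm_le_le hF hrδ
  set c := ((1 - (r + δ) ^ 2) ^ (3 * k))⁻¹
  have hc : 0 ≤ c := by
    obtain ⟨γ, hγ⟩ := hmove origin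
    have hr0 := (norm_nonneg _).trans hγ
    exact inv_nonneg.2 (pow_nonneg (by nlinarith) _)
  have hV : 0 < volume.real (Metric.ball (0 : E) δ) :=
    ENNReal.toReal_pos (Metric.measure_ball_pos _ _ hδ0).ne' measure_ball_lt_top.ne
  refine ⟨c * N / volume.real (Metric.ball (0 : E) δ), by positivity, fun f hf z => ?_⟩
  set I := ∫ w in F, normSq k f w ∂hypMeasure
  have hI : 0 ≤ I := integral_nonneg fun w => normSq_nonneg k f w
  obtain ⟨γ, hγ⟩ := hmove z
  rw [← normSq_smul hf γ, div_mul_eq_mul_div, le_div_iff₀ hV]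
  have hle : ‖f (γ • z)‖ₑ ^ 2 * volume (Metric.ball (0 : E) δ) ≤
      ENNReal.ofReal c * (N * ENNReal.ofReal I) := by
    refine (enorm_sq_mul_volume_ball_le hf.1 (by linarith) hrδ).trans
      ((setLIntegral_enorm_sq_le k f hrδ).trans ?_)
    rw [ofReal_integral_eq_lintegral_ofReal (integrableOn_normSq hF hf)
      (Eventually.of_forall fun w => normSq_nonneg k f w)]
    gcongr
    exact hN _ (continuous_normSq (continuous_of_mem hf)).measurable.ennreal_ofReal
      fun γ w => by rw [normSq_smul hf]
  have hreal := ENNReal.toReal_mono (by finiteness) hle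
  simp only [ENNReal.toReal_mul, ENNReal.toReal_pow, toReal_enorm, ENNReal.toReal_ofReal hc,
    ENNReal.toReal_ofReal hI, ENNReal.toReal_natCast, ← mul_assoc] at hreal
  refine le_trans (mul_le_mul_of_nonneg_right ?_ hV.le) hreal
  exact mul_le_of_le_one_left (sq_nonneg _)
    (pow_le_one₀ (weight_pos _).le (weight_le_one _))

end Finiteness

section InnerProduct

variable {Γ : Subgroup SU21} {F : Set Ball2} {k : ℕ} {f g h : Ball2 → ℂ}

lemma innerHyp_self (F : Set Ball2) (k : ℕ) (f : Ball2 → ℂ) :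
    innerHyp F k f f = ((∫ z in F, normSq k f z ∂hypMeasure : ℝ) : ℂ) := by
  rw [← integral_complex_ofReal]
  simp only [← pairing_self]
  rfl

lemma conj_innerHyp (F : Set Ball2) (k : ℕ) (f h : Ball2 → ℂ) :
    starRingEnd ℂ (innerHyp F k f h) = innerHyp F k h f :=
  integral_conj.symm.trans (integral_congr_ae (Eventually.of_forall (conj_pairing k f h)))

lemma innerHyp_smul_left (F : Set Ball2) (k : ℕ) (c : ℂ) (f h : Ball2 → ℂ) :
    innerHyp F k (c • f) h = c * innerHyp F k f h := by
  rw [innerHyp, innerHyp, ← integral_const_mul]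
  congr 1 with z
  simp only [Pi.smul_apply, smul_eq_mul]
  ring

variable [CompactSpace (PicardSurface Γ)] [DiscreteTopology Γ]

lemma innerHyp_add_left (hF : IsFundamentalDomain Γ F hypMeasure) (hf : f ∈ H0 Γ k)
    (hg : g ∈ H0 Γ k) (hh : h ∈ H0 Γ k) :
    innerHyp F k (f + g) h = innerHyp F k f h + innerHyp F k g h := by
  refine Eq.trans ?_ (integral_add (integrableOn_pairing hF hf hh) (integrableOn_pairing hF hg hh))
  rw [innerHyp]
  congr 1 with z
  simp only [Pi.add_apply]
  ring

/-- The linear form `f ↦ ⟨f, h⟩_hyp` on the space of sections. -/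
def innerHypLeft (hF : IsFundamentalDomain Γ F hypMeasure) (k : ℕ) (h : H0 Γ k) :
    H0 Γ k →ₗ[ℂ] ℂ where
  toFun f := innerHyp F k f h
  map_add' f g := innerHyp_add_left hF f.2 g.2 h.2
  map_smul' c f := innerHyp_smul_left F k c f h

lemma eq_zero_of_integral_normSq_eq_zero (hF : IsFundamentalDomain Γ F hypMeasure)
    (hf : f ∈ H0 Γ k) (h0 : ∫ z in F, normSq k f z ∂hypMeasure = 0) : f = 0 := by
  obtain ⟨C, -, hC⟩ := exists_normSq_le_mul_setIntegral hF k
  funext z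
  have hz := hC f hf z
  rw [h0, mul_zero] at hz
  have hsq := (mul_eq_zero.1 (hz.antisymm (normSq_nonneg k f z))).resolve_left
    (pow_pos (weight_pos z) _).ne'
  exact norm_eq_zero.1 (pow_eq_zero_iff two_ne_zero |>.1 hsq)

/-- The `L²` inner product on the space of sections; the arguments are swapped as Mathlib's inner
products are conjugate-linear in the first variable. -/
@[reducible]
def innerCore (hF : IsFundamentalDomain Γ F hypMeasure) (k : ℕ) :
    InnerProductSpace.Core ℂ (H0 Γ k) where
  inner f g := innerHypLeft hF k f g
  conj_inner_symm f g := conj_innerHyp F k f g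
  re_inner_nonneg f := by
    change 0 ≤ (innerHyp F k f f).re
    rw [innerHyp_self, Complex.ofReal_re]
    exact integral_nonneg fun z => normSq_nonneg k f z
  add_left f g h := by
    change innerHyp F k h (f + g : H0 Γ k) = innerHyp F k h f + innerHyp F k h g
    rw [← conj_innerHyp F k (f + g : H0 Γ k), ← conj_innerHyp F k f, ← conj_innerHyp F k g,
      ← map_add]
    exact congrArg _ (map_add (innerHypLeft hF k h) f g)
  smul_left f g c := by
    change innerHyp F k g (c • f : H0 Γ k) = starRingEnd ℂ c * innerHyp F k g f
    rw [← conj_innerHyp F k (c • f : H0 Γ k), ← conj_innerHyp F k f, ← map_mul]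
    exact congrArg _ (map_smul (innerHypLeft hF k g) c f)
  definite f hf := by
    refine Subtype.ext (eq_zero_of_integral_normSq_eq_zero hF f.2 ?_)
    exact_mod_cast (innerHyp_self F k f).symm.trans hf

/-- The sections `v₁, …, v_m` are orthonormal. -/
def IsOrthonormal (F : Set Ball2) (k : ℕ) {m : ℕ} (v : Fin m → H0 Γ k) : Prop :=
  ∀ i j, innerHyp F k (v i) (v j) = if i = j then 1 else 0

theorem exists_sum_normSq_le (hF : IsFundamentalDomain Γ F hypMeasure) (k : ℕ) :
    ∃ C : ℝ, ∀ (m : ℕ) (v : Fin m → H0 Γ k), IsOrthonormal F k v →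
      ∀ z, ∑ i, normSq k (v i) z ≤ C := by
  obtain ⟨C, hC0, hC⟩ := exists_normSq_le_mul_setIntegral hF k
  refine ⟨C, fun m v hv z => ?_⟩
  let := (innerCore hF k).toNormedAddCommGroup
  let : InnerProductSpace ℂ (H0 Γ k) := InnerProductSpace.ofCore (innerCore hF k).toCore
  have horth : Orthonormal ℂ v :=
    orthonormal_iff_ite.2 fun i j => (hv j i).trans (by simp only [eq_comm])
  have hw : 0 < weight z ^ (3 * k) := pow_pos (weight_pos z) _
  have hnorm (f : H0 Γ k) : ‖f‖ ^ 2 = ∫ z in F, normSq k f z ∂hypMeasure := by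
    rw [← inner_self_eq_norm_sq (𝕜 := ℂ)]
    exact congrArg Complex.re (innerHyp_self F k f)
  have hsum := sum_norm_apply_sq_le_of_orthonormal (C := C / weight z ^ (3 * k))
    (φ := LinearMap.proj z ∘ₗ (H0 Γ k).subtype) (fun f => by
      rw [hnorm, div_mul_eq_mul_div, le_div_iff₀' hw]
      exact hC f f.2 z) (by positivity) horth
  rw [le_div_iff₀' hw, Finset.mul_sum] at hsum
  exact hsum

lemma exists_orthonormal_card_le (hF : IsFundamentalDomain Γ F hypMeasure) (k : ℕ) :
    ∃ n : ℕ, ∀ (m : ℕ) (v : Fin m → H0 Γ k), IsOrthonormal F k v → m ≤ n := by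
  obtain ⟨C, hC⟩ := exists_sum_normSq_le hF k
  refine ⟨⌊C * hypMeasure.real F⌋₊, fun m v hv => Nat.le_floor ?_⟩
  have hone (i : Fin m) : ∫ z in F, normSq k (v i) z ∂hypMeasure = 1 := by
    have h := hv i i
    rw [innerHyp_self, if_pos rfl] at h
    exact_mod_cast h
  have hint (i : Fin m) := integrableOn_normSq hF (v i).2
  calc (m : ℝ) = ∑ i, ∫ z in F, normSq k (v i) z ∂hypMeasure := by simp [hone]
    _ = ∫ z in F, ∑ i, normSq k (v i) z ∂hypMeasure :=
        (integral_finsetSum _ fun i _ => hint i).symm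
    _ ≤ ∫ _ in F, C ∂hypMeasure := by
        refine integral_mono (integrable_finsetSum _ fun i _ => hint i) ?_ (hC m v hv)
        exact integrableOn_const (hypMeasure_fundamentalDomain_ne_top hF)
    _ = C * hypMeasure.real F := by rw [setIntegral_const, smul_eq_mul, mul_comm]

theorem exists_isOrthonormalBasis (hF : IsFundamentalDomain Γ F hypMeasure) (k : ℕ) :
    ∃ (d : ℕ) (ω : Fin d → H0 Γ k), IsOrthonormalBasis Γ F k ω := by
  obtain ⟨n, hn⟩ := exists_orthonormal_card_le hF k
  let := (innerCore hF k).toNormedAddCommGroup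
  let : InnerProductSpace ℂ (H0 Γ k) := InnerProductSpace.ofCore (innerCore hF k).toCore
  have horth {m : ℕ} (v : Fin m → H0 Γ k) (hv : Orthonormal ℂ v) : IsOrthonormal F k v :=
    fun i j => (orthonormal_iff_ite.1 hv j i).trans (by simp only [eq_comm])
  have := finiteDimensional_of_orthonormal_card_le n fun m v hv => hn m v (horth v hv)
  let b := stdOrthonormalBasis ℂ (H0 Γ k)
  refine ⟨_, b, horth b b.orthonormal, ?_⟩
  rw [← b.coe_toBasis]
  exact b.toBasis.span_eq

lemma eq_sum_innerHyp (hF : IsFundamentalDomain Γ F hypMeasure) {d : ℕ} {ω : Fin d → H0 Γ k}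
    (hω : IsOrthonormalBasis Γ F k ω) (f : H0 Γ k) :
    f = ∑ j, innerHyp F k f (ω j) • ω j := by
  obtain ⟨c, rfl⟩ := (Submodule.mem_span_range_iff_exists_fun ℂ).1
    (show f ∈ Submodule.span ℂ (Set.range ω) from hω.2 ▸ Submodule.mem_top)
  have hcoeff (j : Fin d) : innerHypLeft hF k (ω j) (∑ i, c i • ω i) = c j := by
    rw [map_sum]
    simp only [map_smul, smul_eq_mul]
    simp [innerHypLeft, hω.1]
  exact Finset.sum_congr rfl fun j _ => congrArg (· • ω j) (hcoeff j).symm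

end InnerProduct

section Reproducing

/-- The integral of `(1 - |z|²)^{3k}` against the hyperbolic volume, by which the values of the
Bergman kernel of weight `k` are normalized. -/
def weightIntegral (k : ℕ) : ℝ := ∫ z, weight z ^ (3 * k) ∂hypMeasure

lemma integrable_hypMeasure_of_norm_le {W : Type*} [NormedAddCommGroup W] [NormedSpace ℝ W]
    [SecondCountableTopology W] {φ : Ball2 → W} (hφ : Continuous φ) {C : ℝ}
    (hC : ∀ z, ‖φ z‖ ≤ C * weight z ^ 3) : Integrable φ hypMeasure := by
  have hw (z : Ball2) : 0 < weight z ^ 3 := pow_pos (weight_pos z) 3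
  refine integrable_hypMeasure_iff.2 (Integrable.of_bound (C := C) ?_ ?_)
  · exact (((continuous_weight.pow 3).inv₀ fun z => (hw z).ne').smul hφ).aestronglyMeasurable
  · refine Eventually.of_forall fun z => ?_
    rw [norm_smul, Real.norm_of_nonneg (inv_pos.2 (hw z)).le, inv_mul_le_iff₀ (hw z), mul_comm]
    exact hC z

lemma hypMeasure_ne_zero : hypMeasure ≠ 0 := by
  refine (Measure.measure_univ_pos.1 (lt_of_lt_of_le ?_ (eucMeasure_le_hypMeasure Set.univ)))
  rw [eucMeasure, comap_subtype_coe_apply measurableSet_ball, Set.image_univ,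
    Subtype.range_coe_subtype]
  exact Metric.measure_ball_pos volume (0 : E) one_pos

lemma weightIntegral_pos {k : ℕ} (hk : 1 ≤ k) : 0 < weightIntegral k := by
  have hpos (z : Ball2) : 0 < weight z ^ (3 * k) := pow_pos (weight_pos z) _
  refine (integral_pos_iff_support_of_nonneg (fun z => (hpos z).le) ?_).2 ?_
  · refine integrable_hypMeasure_of_norm_le (C := 1) (continuous_weight.pow _) fun z => ?_
    rw [Real.norm_of_nonneg (hpos z).le, one_mul]
    exact pow_le_pow_of_le_one (weight_pos z).le (weight_le_one z) (by lia)
  · rw [Function.support_eq_univ fun z => (hpos z).ne']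
    exact Measure.measure_univ_pos.2 hypMeasure_ne_zero

variable {k : ℕ} {f h : Ball2 → ℂ}

lemma norm_pairing_one_le (hk : 2 ≤ k) {M : ℝ} {z : Ball2} (hM : normSq k f z ≤ M) :
    ‖pairing k f 1 z‖ ≤ √M * weight z ^ 3 := by
  have hw := weight_pos z
  rw [pairing, Pi.one_apply, map_one, mul_one, norm_mul, Complex.norm_real,
    Real.norm_of_nonneg (by positivity), ← pow_le_pow_iff_left₀ (by positivity) (by positivity)
    two_ne_zero, mul_pow, mul_pow, Real.sq_sqrt ((normSq_nonneg k f z).trans hM)]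
  calc (weight z ^ (3 * k)) ^ 2 * ‖f z‖ ^ 2 = normSq k f z * weight z ^ (3 * k) := by
        rw [normSq]; ring
    _ ≤ M * weight z ^ (3 * 2) := by
        have hle : weight z ^ (3 * k) ≤ weight z ^ (3 * 2) :=
          pow_le_pow_of_le_one hw.le (weight_le_one z) (by lia)
        exact mul_le_mul hM hle (by positivity) ((normSq_nonneg k f z).trans hM)
    _ = M * (weight z ^ 3) ^ 2 := by rw [← pow_mul]

lemma integrable_pairing_one (hk : 2 ≤ k) (hf : IsHolomorphic f) {M : ℝ}
    (hM : ∀ z, normSq k f z ≤ M) : Integrable (pairing k f 1) hypMeasure :=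
  integrable_hypMeasure_of_norm_le (continuous_pairing hf.continuous continuous_const)
    fun z => norm_pairing_one_le hk (hM z)

theorem integral_pairing_one (hk : 2 ≤ k) (hf : IsHolomorphic f) {M : ℝ}
    (hM : ∀ z, normSq k f z ≤ M) :
    ∫ z, pairing k f 1 z ∂hypMeasure = f origin * weightIntegral k := by
  set ρ : E → ℝ := fun u => ((1 - ‖u‖ ^ 2) ^ 3)⁻¹ * (1 - ‖u‖ ^ 2) ^ (3 * k) with hρ
  have hmul (z : Ball2) : ρ z.1 • extendZero f z.1 = (weight z ^ 3)⁻¹ • pairing k f 1 z := by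
    rw [extendZero_apply _ z.2, pairing, Pi.one_apply, map_one, mul_one, hρ, mul_smul]
    exact congrArg _ Complex.real_smul
  have hint : IntegrableOn (fun u => ρ u • extendZero f u) (Metric.ball 0 1) := by
    simp only [← integrable_eucMeasure_iff, hmul]
    exact integrable_hypMeasure_iff.1 (integrable_pairing_one hk hf hM)
  have hmean := integral_smul_eq_integral_smul_apply_zero Metric.isOpen_ball balanced_ball_zero
    (ae_restrict_mem measurableSet_ball) hf (fun c u => by simp only [hρ, Circle.norm_smul]) hint
  rw [← integral_eucMeasure, ← integral_eucMeasure] at hmean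
  simp only [hmul] at hmean
  rw [weightIntegral, integral_hypMeasure, integral_hypMeasure, hmean, mul_comm, Complex.real_smul,
    show extendZero f 0 = f origin from extendZero_apply _ origin.2]
  rfl

variable {Γ : Subgroup SU21} {F : Set Ball2}

lemma pullback_jacobian_inv_pow (g : SU21) (k : ℕ) :
    pullback k g (fun z => jacobian g⁻¹ z ^ k) = 1 := by
  funext z
  rw [pullback, ← mul_pow, ← jacobian_mul, inv_mul_cancel, jacobian_one, one_pow, Pi.one_apply]

lemma pairing_jacobian_inv_pow_smul (g : SU21) (k : ℕ) (f : Ball2 → ℂ) (z : Ball2) :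
    pairing k f (fun z => jacobian g⁻¹ z ^ k) (g • z) = pairing k (pullback k g f) 1 z := by
  rw [← pullback_jacobian_inv_pow g k, pairing_pullback]

variable [CompactSpace (PicardSurface Γ)]

lemma integrable_pairing_jacobian_inv_pow (hk : 2 ≤ k) (g : SU21) (hf : f ∈ H0 Γ k) :
    Integrable (pairing k f fun z => jacobian g⁻¹ z ^ k) hypMeasure := by
  obtain ⟨M, hM⟩ := exists_normSq_le hf
  rw [← (measurePreserving_smul g hypMeasure).integrable_comp_emb
    (MeasurableEquiv.smul g).measurableEmbedding]
  refine (integrable_pairing_one hk (isHolomorphic_pullback k g hf.1) (M := M) fun z => ?_).congr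
    (Eventually.of_forall fun z => (pairing_jacobian_inv_pow_smul g k f z).symm)
  rw [normSq_pullback]
  exact hM _

lemma integral_pairing_jacobian_inv_pow (hk : 2 ≤ k) (g : SU21) (hf : f ∈ H0 Γ k) :
    ∫ z, pairing k f (fun z => jacobian g⁻¹ z ^ k) z ∂hypMeasure =
      pullback k g f origin * weightIntegral k := by
  obtain ⟨M, hM⟩ := exists_normSq_le hf
  rw [← integral_smul_eq_self (μ := hypMeasure) _ (g := g)]
  simp only [pairing_jacobian_inv_pow_smul]
  refine integral_pairing_one hk (isHolomorphic_pullback k g hf.1) (M := M) fun z => ?_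
  rw [normSq_pullback]
  exact hM _

variable [DiscreteTopology Γ]

-- The inner product unfolds: the sum over `Γ` inside the integral over `F` turns the latter into
-- an integral over the whole ball, to which the mean value property applies.
theorem innerHyp_poincareSeries (hF : IsFundamentalDomain Γ F hypMeasure) (hk : 2 ≤ k) (g : SU21)
    (hf : f ∈ H0 Γ k) :
    innerHyp F k f (poincareSeries Γ g k) = pullback k g f origin * weightIntegral k := by
  rw [← integral_pairing_jacobian_inv_pow hk g hf, integral_eq_setIntegral_tsum_smul hF
    (integrable_pairing_jacobian_inv_pow hk g hf)]
  refine integral_congr_ae (Eventually.of_forall fun z => ?_)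
  have hγ (γ : Γ) : pairing k f (fun w => jacobian g⁻¹ w ^ k) (γ • z) =
      pairing k f (fun w => jacobian (g⁻¹ * γ) w ^ k) z := by
    rw [show γ • z = (γ : SU21) • z from rfl, ← pairing_pullback, pullback_of_mem hf]
    congr 1
    funext w
    rw [pullback, jacobian_mul, mul_pow]
  simp only [tsum_congr hγ]
  simp only [pairing, poincareSeries, Complex.conj_tsum, tsum_mul_left]
  rfl

end Reproducing

section BergmanKernel

variable {Γ : Subgroup SU21} {F : Set Ball2} {k : ℕ}

lemma bergmanKernel_self {d : ℕ} (ω : Fin d → H0 Γ k) (z : Ball2) :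
    bergmanKernel ω z z = ((∑ j, ‖(ω j : Ball2 → ℂ) z‖ ^ 2 : ℝ) : ℂ) := by
  rw [bergmanKernel, Complex.ofReal_sum]
  refine Finset.sum_congr rfl fun j _ => ?_
  rw [Complex.mul_conj, Complex.normSq_eq_norm_sq]

lemma bergmanNorm_eq_sum_normSq {d : ℕ} (ω : Fin d → H0 Γ k) (z : Ball2) :
    bergmanNorm ω z = ∑ j, normSq k (ω j) z := by
  rw [bergmanNorm, bergmanKernel_self, Complex.norm_real,
    Real.norm_of_nonneg (Finset.sum_nonneg fun j _ => sq_nonneg _), Finset.mul_sum]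
  rfl

lemma pullback_poincareSeries_origin (Γ : Subgroup SU21) (g : SU21) (k : ℕ) :
    pullback k g (poincareSeries Γ g k) origin =
      ∑' γ : Γ, jacobian (g⁻¹ * γ * g) origin ^ k := by
  rw [pullback, poincareSeries, ← tsum_mul_right]
  simp only [jacobian_mul _ g, mul_pow]

lemma norm_jacobian_conj_pow_le (g h : SU21) (hk : 2 ≤ k) :
    ‖jacobian (g⁻¹ * h * g) origin ^ k‖ ≤ 64 * ‖jacobian h (g • origin)‖ ^ 2 := by
  rw [norm_pow]
  calc ‖jacobian (g⁻¹ * h * g) origin‖ ^ k ≤ ‖jacobian (g⁻¹ * h * g) origin‖ ^ 2 :=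
        pow_le_pow_of_le_one (norm_nonneg _) (norm_jacobian_origin_le_one _) hk
    _ ≤ (8 * ‖jacobian h (g • origin)‖) ^ 2 := by
        gcongr
        exact norm_jacobian_conj_le g h
    _ = 64 * ‖jacobian h (g • origin)‖ ^ 2 := by ring

variable [CompactSpace (PicardSurface Γ)] [DiscreteTopology Γ]

theorem bergmanNorm_mul_weightIntegral (hF : IsFundamentalDomain Γ F hypMeasure) (hk : 2 ≤ k)
    {d : ℕ} {ω : Fin d → H0 Γ k} (hω : IsOrthonormalBasis Γ F k ω) (g : SU21) :
    ((bergmanNorm ω (g • origin) * weightIntegral k : ℝ) : ℂ) =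
      ∑' γ : Γ, jacobian (g⁻¹ * γ * g) origin ^ k := by
  set a := fun j => pullback k g (ω j) origin
  have hinner (j : Fin d) : innerHyp F k (poincareSeries Γ g k) (ω j) =
      starRingEnd ℂ (a j) * weightIntegral k := by
    rw [← conj_innerHyp, innerHyp_poincareSeries hF hk g (ω j).2, map_mul, Complex.conj_ofReal]
  have hexp := congrArg Subtype.val
    (eq_sum_innerHyp hF hω ⟨poincareSeries Γ g k, poincareSeries_mem Γ g hk⟩)
  have hpull : pullback k g (poincareSeries Γ g k) origin =
      ∑ j, starRingEnd ℂ (a j) * weightIntegral k * a j := by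
    simp only [hinner, Submodule.coe_sum, Submodule.coe_smul] at hexp
    rw [hexp, pullback, Finset.sum_apply, Finset.sum_mul]
    exact Finset.sum_congr rfl fun j _ => mul_assoc _ _ _
  have hnorm (j : Fin d) : (normSq k (ω j) (g • origin) : ℂ) = a j * starRingEnd ℂ (a j) := by
    rw [← pairing_self, ← pairing_pullback, pairing, weight_origin, one_pow, Complex.ofReal_one,
      one_mul]
  rw [← pullback_poincareSeries_origin, hpull, bergmanNorm_eq_sum_normSq, Complex.ofReal_mul,
    Complex.ofReal_sum, Finset.sum_mul]
  refine Finset.sum_congr rfl fun j _ => ?_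
  rw [hnorm]
  ring

theorem exists_bergmanNorm_mul_weightIntegral_le (hF : IsFundamentalDomain Γ F hypMeasure) {r : ℝ}
    (hr : r < 1) :
    ∃ M : ℝ, ∀ k, 2 ≤ k → ∀ (d : ℕ) (ω : Fin d → H0 Γ k), IsOrthonormalBasis Γ F k ω →
      ∀ x : Ball2, ‖x.1‖ ≤ r → bergmanNorm ω x * weightIntegral k ≤ M := by
  obtain ⟨u, hu, hle⟩ := exists_summable_norm_jacobian_sq_le Γ hr
  refine ⟨∑' γ, 64 * u γ, fun k hk d ω hω x hx => ?_⟩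
  obtain ⟨g, rfl⟩ := exists_smul_origin_eq x
  have hbound := tsum_of_norm_bounded (hu.mul_left 64).hasSum fun γ : Γ =>
    (norm_jacobian_conj_pow_le g γ hk).trans
      (mul_le_mul_of_nonneg_left (hle γ _ hx) (by norm_num))
  rw [← bergmanNorm_mul_weightIntegral hF hk hω, Complex.norm_real] at hbound
  exact (le_abs_self _).trans hbound

-- The term of the identity is `1` and, as `|jacobian γ origin| < 1` for a `γ` that moves the
-- origin, all the others tend to `0`.
theorem tendsto_bergmanNorm_mul_weightIntegral (hF : IsFundamentalDomain Γ F hypMeasure)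
    {d : ℕ → ℕ} {ω : (k : ℕ) → Fin (d k) → H0 Γ k}
    (hω : ∀ k, 1 ≤ k → IsOrthonormalBasis Γ F k (ω k)) {z : Ball2}
    (hz : ∀ γ ∈ Γ, γ • z = z → γ = 1) :
    Tendsto (fun k => bergmanNorm (ω k) z * weightIntegral k) atTop (𝓝 1) := by
  classical
  obtain ⟨g, rfl⟩ := exists_smul_origin_eq z
  obtain ⟨u, hu, hle⟩ := exists_summable_norm_jacobian_sq_le Γ (mem_ball_zero_iff.1 (g • origin).2)
  have hlim : Tendsto (fun k : ℕ => ∑' γ : Γ, jacobian (g⁻¹ * γ * g) origin ^ k) atTop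
      (𝓝 (∑' γ : Γ, if γ = 1 then 1 else 0)) := by
    refine tendsto_tsum_of_dominated_convergence (hu.mul_left 64) (fun γ => ?_)
      ((eventually_ge_atTop 2).mono fun k hk γ => (norm_jacobian_conj_pow_le g γ hk).trans
        (mul_le_mul_of_nonneg_left (hle γ _ le_rfl) (by norm_num)))
    split_ifs with hγ
    · simp [hγ, jacobian_one]
    · refine tendsto_pow_atTop_nhds_zero_of_norm_lt_one (norm_jacobian_origin_lt_one fun h => ?_)
      rw [mul_smul, mul_smul, inv_smul_eq_iff] at h
      exact hγ (Subtype.ext (hz γ γ.2 h))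
  rw [tsum_ite_eq] at hlim
  refine ((Complex.continuous_re.tendsto _).comp hlim).congr' ?_
  filter_upwards [eventually_ge_atTop 2] with k hk
  rw [Function.comp_apply, ← bergmanNorm_mul_weightIntegral hF hk (hω k (by lia)) g,
    Complex.ofReal_re]

end BergmanKernel

section Wirtinger

variable {φ ψ : E → ℂ} {p : E → ℝ} {z : E}

lemma norm_e (j : Fin 2) : ‖e j‖ = 1 := by simp [e]

lemma dZ_congr (j : Fin 2) (h : φ =ᶠ[𝓝 z] ψ) : dZ j φ z = dZ j ψ z := by
  rw [dZ, dZ, h.fderiv_eq]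

lemma dZbar_congr (l : Fin 2) (h : φ =ᶠ[𝓝 z] ψ) : dZbar l φ z = dZbar l ψ z := by
  rw [dZbar, dZbar, h.fderiv_eq]

lemma fderiv_const_mul_add_apply (c : ℂ) (hφ : DifferentiableAt ℝ φ z)
    (hψ : DifferentiableAt ℝ ψ z) (v : E) :
    fderiv ℝ (fun w => c * φ w + ψ w) z v = c * fderiv ℝ φ z v + fderiv ℝ ψ z v := by
  rw [fderiv_fun_add (hφ.const_mul c) hψ, fderiv_const_mul hφ]
  rfl

lemma dZ_const_mul_add (j : Fin 2) (c : ℂ) (hφ : DifferentiableAt ℝ φ z)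
    (hψ : DifferentiableAt ℝ ψ z) :
    dZ j (fun w => c * φ w + ψ w) z = c * dZ j φ z + dZ j ψ z := by
  simp only [dZ, fderiv_const_mul_add_apply c hφ hψ]
  ring

lemma dZbar_const_mul_add (l : Fin 2) (c : ℂ) (hφ : DifferentiableAt ℝ φ z)
    (hψ : DifferentiableAt ℝ ψ z) :
    dZbar l (fun w => c * φ w + ψ w) z = c * dZbar l φ z + dZbar l ψ z := by
  simp only [dZbar, fderiv_const_mul_add_apply c hφ hψ]
  ring

lemma differentiableAt_dZbar (l : Fin 2) (hφ : ContDiffAt ℝ 2 φ z) :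
    DifferentiableAt ℝ (dZbar l φ) z := by
  have hfderiv : DifferentiableAt ℝ (fderiv ℝ φ) z :=
    (hφ.fderiv_right (m := 1) (by norm_num)).differentiableAt (by norm_num)
  have happly (v : E) : DifferentiableAt ℝ (fun w => fderiv ℝ φ w v) z :=
    hfderiv.clm_apply (differentiableAt_const v)
  exact ((happly (e l)).add ((happly (Complex.I • e l)).const_mul _)).const_mul _

lemma fderiv_ofReal_comp_apply (hp : DifferentiableAt ℝ p z) (v : E) :
    fderiv ℝ (fun w => (p w : ℂ)) z v = fderiv ℝ p z v := by
  have h : HasFDerivAt (fun w => (p w : ℂ)) (Complex.ofRealCLM ∘L fderiv ℝ p z) z :=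
    Complex.ofRealCLM.hasFDerivAt.comp z hp.hasFDerivAt
  rw [h.fderiv]
  rfl

lemma dZbar_log (l : Fin 2) (hp : DifferentiableAt ℝ p z) (h0 : p z ≠ 0) :
    dZbar l (fun w => (Real.log (p w) : ℂ)) z = (p z)⁻¹ • dZbar l (fun w => (p w : ℂ)) z := by
  simp only [dZbar, fderiv_ofReal_comp_apply hp, fderiv_ofReal_comp_apply (hp.log h0),
    fderiv.log hp h0, _root_.smul_apply, smul_eq_mul, Complex.real_smul]
  push_cast
  ring

lemma dZ_inv_smul (j : Fin 2) (hp : DifferentiableAt ℝ p z) (h0 : p z ≠ 0)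
    (hφ : DifferentiableAt ℝ φ z) :
    dZ j (fun w => (p w)⁻¹ • φ w) z =
      (p z)⁻¹ • dZ j φ z - (p z ^ 2)⁻¹ • (φ z * dZ j (fun w => (p w : ℂ)) z) := by
  have hfderiv (v : E) : fderiv ℝ (fun w => (p w)⁻¹ • φ w) z v =
      (p z)⁻¹ • fderiv ℝ φ z v - ((p z ^ 2)⁻¹ * fderiv ℝ p z v) • φ z := by
    have hinv : HasFDerivAt (fun w => (p w)⁻¹ • φ w) _ z :=
      ((hasDerivAt_inv h0).comp_hasFDerivAt z hp.hasFDerivAt).smul hφ.hasFDerivAt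
    rw [hinv.fderiv]
    simp [sub_eq_add_neg]
  simp only [dZ, hfderiv, fderiv_ofReal_comp_apply hp]
  simp only [Complex.real_smul]
  push_cast
  ring

section Inner

variable {W : Type*} [NormedAddCommGroup W] [InnerProductSpace ℂ W] {f g : E → W}

lemma fderiv_real_inner_apply (hf : DifferentiableAt ℂ f z) (hg : DifferentiableAt ℂ g z) (v : E) :
    fderiv ℝ (fun w => inner ℂ (f w) (g w)) z v =
      inner ℂ (f z) (fderiv ℂ g z v) + inner ℂ (fderiv ℂ f z v) (g z) := by
  have h := (hf.hasFDerivAt.restrictScalars ℝ).inner ℂ (hg.hasFDerivAt.restrictScalars ℝ)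
  rw [h.fderiv]
  rfl

lemma dZ_inner (j : Fin 2) (hf : DifferentiableAt ℂ f z) (hg : DifferentiableAt ℂ g z) :
    dZ j (fun w => inner ℂ (f w) (g w)) z = inner ℂ (f z) (fderiv ℂ g z (e j)) := by
  simp only [dZ, fderiv_real_inner_apply hf hg, map_smul, inner_smul_left, inner_smul_right,
    Complex.conj_I]
  linear_combination (-1 / 2 * inner ℂ (f z) (fderiv ℂ g z (e j)) +
    1 / 2 * inner ℂ (fderiv ℂ f z (e j)) (g z)) * Complex.I_sq

lemma dZbar_inner (l : Fin 2) (hf : DifferentiableAt ℂ f z) (hg : DifferentiableAt ℂ g z) :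
    dZbar l (fun w => inner ℂ (f w) (g w)) z = inner ℂ (fderiv ℂ f z (e l)) (g z) := by
  simp only [dZbar, fderiv_real_inner_apply hf hg, map_smul, inner_smul_left, inner_smul_right,
    Complex.conj_I]
  linear_combination (1 / 2 * inner ℂ (f z) (fderiv ℂ g z (e l)) -
    1 / 2 * inner ℂ (fderiv ℂ f z (e l)) (g z)) * Complex.I_sq

variable {U : Set E} {G : E → W}

lemma ofReal_norm_sq (x : W) : ((‖x‖ ^ 2 : ℝ) : ℂ) = inner ℂ x x := by
  simp [inner_self_eq_norm_sq_to_K]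

lemma differentiableAt_norm_sq_comp (hG : DifferentiableAt ℂ G z) :
    DifferentiableAt ℝ (fun w => ‖G w‖ ^ 2) z :=
  (hG.restrictScalars ℝ).norm_sq ℂ

lemma dZbar_log_norm_sq (l : Fin 2) (hG : DifferentiableAt ℂ G z) (h0 : G z ≠ 0) :
    dZbar l (fun w => (Real.log (‖G w‖ ^ 2) : ℂ)) z =
      (‖G z‖ ^ 2)⁻¹ • inner ℂ (fderiv ℂ G z (e l)) (G z) := by
  rw [dZbar_log l (differentiableAt_norm_sq_comp hG) (by simpa using h0)]
  simp only [ofReal_norm_sq, dZbar_inner l hG hG]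

lemma dZbar_log_norm_sq_eventuallyEq (l : Fin 2) (hU : IsOpen U) (hG : DifferentiableOn ℂ G U)
    (hz : z ∈ U) (h0 : G z ≠ 0) :
    dZbar l (fun w => (Real.log (‖G w‖ ^ 2) : ℂ)) =ᶠ[𝓝 z] fun w =>
      (‖G w‖ ^ 2)⁻¹ • inner ℂ (fderiv ℂ G w (e l)) (G w) := by
  have hGz := hG.differentiableAt (hU.mem_nhds hz)
  filter_upwards [hU.mem_nhds hz, hGz.continuousAt.eventually_ne h0] with w hw hw0
  exact dZbar_log_norm_sq l (hG.differentiableAt (hU.mem_nhds hw)) hw0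

variable [CompleteSpace W]

lemma differentiableAt_inner_fderiv (l : Fin 2) (hU : IsOpen U) (hG : DifferentiableOn ℂ G U)
    (hz : z ∈ U) :
    DifferentiableAt ℝ (fun w => inner ℂ (fderiv ℂ G w (e l)) (G w)) z :=
  (((differentiableOn_fderiv_apply hU hG (e l)).differentiableAt
    (hU.mem_nhds hz)).restrictScalars ℝ).inner ℂ
      ((hG.differentiableAt (hU.mem_nhds hz)).restrictScalars ℝ)

lemma differentiableAt_dZbar_log_norm_sq (l : Fin 2) (hU : IsOpen U)
    (hG : DifferentiableOn ℂ G U) (hz : z ∈ U) (h0 : G z ≠ 0) :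
    DifferentiableAt ℝ (dZbar l fun w => (Real.log (‖G w‖ ^ 2) : ℂ)) z := by
  refine DifferentiableAt.congr_of_eventuallyEq ?_ (dZbar_log_norm_sq_eventuallyEq l hU hG hz h0)
  exact ((differentiableAt_norm_sq_comp (hG.differentiableAt (hU.mem_nhds hz))).inv
    (by simpa using h0)).smul (differentiableAt_inner_fderiv l hU hG hz)

lemma dZ_dZbar_log_norm_sq (j l : Fin 2) (hU : IsOpen U) (hG : DifferentiableOn ℂ G U)
    (hz : z ∈ U) (h0 : G z ≠ 0) :
    dZ j (dZbar l fun w => (Real.log (‖G w‖ ^ 2) : ℂ)) z =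
      (‖G z‖ ^ 2)⁻¹ • inner ℂ (fderiv ℂ G z (e l)) (fderiv ℂ G z (e j)) -
        ((‖G z‖ ^ 2) ^ 2)⁻¹ •
          (inner ℂ (fderiv ℂ G z (e l)) (G z) * inner ℂ (G z) (fderiv ℂ G z (e j))) := by
  have hGz := hG.differentiableAt (hU.mem_nhds hz)
  have hG' := (differentiableOn_fderiv_apply hU hG (e l)).differentiableAt (hU.mem_nhds hz)
  rw [dZ_congr j (dZbar_log_norm_sq_eventuallyEq l hU hG hz h0),
    dZ_inv_smul j (differentiableAt_norm_sq_comp hGz) (by simpa using h0)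
      (differentiableAt_inner_fderiv l hU hG hz), dZ_inner j hG' hGz]
  simp only [ofReal_norm_sq, dZ_inner j hGz hGz]

lemma norm_dZ_dZbar_log_norm_sq_le (j l : Fin 2) (hU : IsOpen U) (hG : DifferentiableOn ℂ G U)
    (hz : z ∈ U) (h0 : G z ≠ 0) {K : ℝ} (hK : ‖fderiv ℂ G z‖ ≤ K * ‖G z‖) :
    ‖dZ j (dZbar l fun w => (Real.log (‖G w‖ ^ 2) : ℂ)) z‖ ≤ 2 * K ^ 2 := by
  have : 0 < ‖G z‖ := norm_pos_iff.2 h0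
  have happly (i : Fin 2) : ‖fderiv ℂ G z (e i)‖ ≤ K * ‖G z‖ := by
    simpa [norm_e] using ((fderiv ℂ G z).le_opNorm (e i)).trans
      (mul_le_mul_of_nonneg_right hK (norm_nonneg _))
  have hKG : 0 ≤ K * ‖G z‖ := (norm_nonneg _).trans hK
  rw [dZ_dZbar_log_norm_sq j l hU hG hz h0]
  calc _ ≤ (‖G z‖ ^ 2)⁻¹ * (K * ‖G z‖ * (K * ‖G z‖)) +
        ((‖G z‖ ^ 2) ^ 2)⁻¹ * (K * ‖G z‖ * ‖G z‖ * (‖G z‖ * (K * ‖G z‖))) := by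
        refine (norm_sub_le _ _).trans ?_
        rw [norm_smul, norm_smul, norm_mul, Real.norm_of_nonneg (by positivity),
          Real.norm_of_nonneg (by positivity)]
        gcongr
        · exact (norm_inner_le_norm _ _).trans (by gcongr <;> exact happly _)
        · exact (norm_inner_le_norm _ _).trans (by gcongr; exact happly _)
        · exact (norm_inner_le_norm _ _).trans (by gcongr; exact happly _)
    _ = 2 * K ^ 2 := by field_simp; ring

end Inner

end Wirtinger

section VolumeForm

lemma norm_halfWedgeSq_le {α : E → E → ℂ} {v : Fin 4 → E} {C : ℝ}
    (h : ∀ a b, ‖α (v a) (v b)‖ ≤ C) : ‖halfWedgeSq α v‖ ≤ 3 * C ^ 2 := by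
  have hmul (a b c d : Fin 4) : ‖α (v a) (v b) * α (v c) (v d)‖ ≤ C ^ 2 := by
    rw [norm_mul, sq]
    exact mul_le_mul (h a b) (h c d) (norm_nonneg _) ((norm_nonneg _).trans (h a b))
  calc ‖halfWedgeSq α v‖ ≤ C ^ 2 + C ^ 2 + C ^ 2 :=
        norm_add_le_of_le (norm_sub_le_of_le (hmul 0 1 2 3) (hmul 0 2 1 3)) (hmul 0 3 1 2)
    _ = 3 * C ^ 2 := by ring

lemma norm_ddbar_le {φ : E → ℂ} {z : E} {T : ℝ} (hT : ∀ j l, ‖dZ j (dZbar l φ) z‖ ≤ T)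
    (u v : E) : ‖ddbar φ z u v‖ ≤ 8 * T * (‖u‖ * ‖v‖) := by
  have hcoord (j l : Fin 2) :
      ‖u j * starRingEnd ℂ (v l) - v j * starRingEnd ℂ (u l)‖ ≤ 2 * (‖u‖ * ‖v‖) := by
    calc _ ≤ ‖u j‖ * ‖v l‖ + ‖v j‖ * ‖u l‖ := by
          simpa only [norm_mul, RCLike.norm_conj] using
            norm_sub_le (u j * starRingEnd ℂ (v l)) (v j * starRingEnd ℂ (u l))
      _ ≤ ‖u‖ * ‖v‖ + ‖v‖ * ‖u‖ := by gcongr <;> exact PiLp.norm_apply_le _ _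
      _ = 2 * (‖u‖ * ‖v‖) := by ring
  calc ‖ddbar φ z u v‖ ≤ ∑ _j : Fin 2, ∑ _l : Fin 2, T * (2 * (‖u‖ * ‖v‖)) :=
        norm_sum_le_of_le _ fun j _ => norm_sum_le_of_le _ fun l _ =>
          norm_mul_le_of_le (hT j l) (hcoord j l)
    _ = 8 * T * (‖u‖ * ‖v‖) := by
        simp only [Fin.sum_univ_two]
        ring

lemma norm_frame (a : Fin 4) : ‖frame a‖ = 1 := by
  fin_cases a <;> simp [frame, norm_smul, norm_e]

variable {Γ : Subgroup SU21} {k d : ℕ} {ω : Fin d → H0 Γ k} {z : Ball2}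

lemma norm_bergmanMetric_le (u v : E) :
    ‖bergmanMetric ω z u v‖ ≤
      ‖ddbar (extendZero fun x => (Real.log (bergmanNorm ω x) : ℂ)) z.1 u v‖ := by
  have hfactor : ‖-(Complex.I / (2 * Real.pi))‖ ≤ 1 := by
    rw [norm_neg, norm_div, Complex.norm_I, norm_mul, Complex.norm_real,
      Real.norm_of_nonneg Real.pi_pos.le, RCLike.norm_ofNat, div_le_one (by positivity)]
    linarith [Real.pi_gt_three]
  rw [bergmanMetric, norm_mul]
  exact mul_le_of_le_one_left (norm_nonneg _) hfactor

lemma norm_volRatio_le {T : ℝ}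
    (hT : ∀ j l, ‖dZ j (dZbar l (extendZero fun x => (Real.log (bergmanNorm ω x) : ℂ))) z.1‖ ≤ T) :
    ‖volRatio ω z‖ ≤ 3 * (8 * T) ^ 2 / ‖hypVol z frame‖ := by
  rw [volRatio, norm_div]
  gcongr
  refine norm_halfWedgeSq_le fun a b => (norm_bergmanMetric_le _ _).trans ?_
  simpa only [norm_frame, mul_one] using norm_ddbar_le hT (frame a) (frame b)

end VolumeForm

section HessianBound

/-- The Kähler potential of the hyperbolic metric, as a function on `ℂ²`. -/
def logWeight (x : E) : ℂ := (Real.log (1 - ‖x‖ ^ 2) : ℂ)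

lemma contDiffAt_logWeight (z : Ball2) : ContDiffAt ℝ 2 logWeight z.1 := by
  have hweight : ContDiffAt ℝ 2 (fun x : E => 1 - ‖x‖ ^ 2) z.1 :=
    contDiffAt_const.sub (contDiff_norm_sq ℝ).contDiffAt
  exact Complex.ofRealCLM.contDiff.contDiffAt.comp z.1 (hweight.log (weight_pos z).ne')

variable {Γ : Subgroup SU21} {k d : ℕ}

/-- The lift `z ↦ (f₁(z), …, f_d(z))` to affine space of the Kodaira map of the sections
`ω_j = f_j (dz₁ ∧ dz₂)^{⊗k}`; its squared norm is the Bergman kernel on the diagonal. -/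
def kodairaMap (ω : Fin d → H0 Γ k) (x : E) : EuclideanSpace ℂ (Fin d) :=
  WithLp.toLp 2 fun j => extendZero (ω j) x

variable (ω : Fin d → H0 Γ k) {z : Ball2}

lemma differentiableOn_kodairaMap : DifferentiableOn ℂ (kodairaMap ω) (Metric.ball 0 1) :=
  differentiableOn_euclidean.2 fun j => (ω j).2.1

lemma bergmanNorm_eq (z : Ball2) :
    bergmanNorm ω z = weight z ^ (3 * k) * ‖kodairaMap ω z.1‖ ^ 2 := by
  have hnonneg : 0 ≤ ∑ j, ‖(ω j : Ball2 → ℂ) z‖ ^ 2 := Finset.sum_nonneg fun j _ => sq_nonneg _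
  rw [bergmanNorm, bergmanKernel_self, Complex.norm_real, Real.norm_of_nonneg hnonneg,
    EuclideanSpace.norm_sq_eq (kodairaMap ω z.1)]
  simp only [kodairaMap, extendZero_apply _ z.2, weight]

lemma extendZero_log_bergmanNorm_eventuallyEq (h0 : kodairaMap ω z.1 ≠ 0) :
    (extendZero fun x => (Real.log (bergmanNorm ω x) : ℂ)) =ᶠ[𝓝 z.1] fun w =>
      (3 * k : ℂ) * logWeight w + (Real.log (‖kodairaMap ω w‖ ^ 2) : ℂ) := by
  have hball := Metric.isOpen_ball.mem_nhds z.2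
  have hcont := ((differentiableOn_kodairaMap ω).differentiableAt hball).continuousAt
  filter_upwards [hball, hcont.eventually_ne h0] with w hw hw0
  rw [extendZero_apply _ hw, bergmanNorm_eq, Real.log_mul
    (pow_pos (weight_pos ⟨w, hw⟩) _).ne' (pow_ne_zero 2 (norm_ne_zero_iff.2 hw0)),
    Real.log_pow, logWeight, weight]
  push_cast
  rfl

lemma dZbar_log_bergmanNorm_eventuallyEq (l : Fin 2) (h0 : kodairaMap ω z.1 ≠ 0) :
    dZbar l (extendZero fun x => (Real.log (bergmanNorm ω x) : ℂ)) =ᶠ[𝓝 z.1] fun w =>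
      (3 * k : ℂ) * dZbar l logWeight w +
        dZbar l (fun w => (Real.log (‖kodairaMap ω w‖ ^ 2) : ℂ)) w := by
  have hball := Metric.isOpen_ball.mem_nhds z.2
  have hcont := ((differentiableOn_kodairaMap ω).differentiableAt hball).continuousAt
  filter_upwards [hball, hcont.eventually_ne h0] with w hw hw0
  have hlog : DifferentiableAt ℝ (fun w => (Real.log (‖kodairaMap ω w‖ ^ 2) : ℂ)) w :=
    Complex.ofRealCLM.differentiableAt.comp w <|
      (differentiableAt_norm_sq_comp ((differentiableOn_kodairaMap ω).differentiableAt
        (Metric.isOpen_ball.mem_nhds hw))).log (pow_ne_zero 2 (norm_ne_zero_iff.2 hw0))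
  rw [dZbar_congr l (extendZero_log_bergmanNorm_eventuallyEq ω (z := ⟨w, hw⟩) hw0),
    dZbar_const_mul_add l _
      ((contDiffAt_logWeight ⟨w, hw⟩).differentiableAt (by norm_num)) hlog]

lemma norm_dZ_dZbar_log_bergmanNorm_le (h0 : kodairaMap ω z.1 ≠ 0) {K : ℝ}
    (hK : ‖fderiv ℂ (kodairaMap ω) z.1‖ ≤ K * ‖kodairaMap ω z.1‖) (j l : Fin 2) :
    ‖dZ j (dZbar l (extendZero fun x => (Real.log (bergmanNorm ω x) : ℂ))) z.1‖ ≤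
      3 * k * ‖dZ j (dZbar l logWeight) z.1‖ + 2 * K ^ 2 := by
  have hhol := differentiableOn_kodairaMap ω
  rw [dZ_congr j (dZbar_log_bergmanNorm_eventuallyEq ω l h0), dZ_const_mul_add j _
    (differentiableAt_dZbar l (contDiffAt_logWeight z))
    (differentiableAt_dZbar_log_norm_sq l Metric.isOpen_ball hhol z.2 h0)]
  refine norm_add_le_of_le ?_ (norm_dZ_dZbar_log_norm_sq_le j l Metric.isOpen_ball hhol z.2 h0 hK)
  simp

end HessianBound

section GradientBound

lemma half_pow_le_weight_pow {k : ℕ} (hk : k ≠ 0) {z x : Ball2}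
    (hx : ‖x.1 - z.1‖ ≤ weight z / (12 * k)) : weight z ^ (3 * k) / 2 ≤ weight x ^ (3 * k) := by
  have hk1 : (1 : ℝ) ≤ k := by exact_mod_cast Nat.one_le_iff_ne_zero.2 hk
  have hlipschitz : weight z - 2 * ‖x.1 - z.1‖ ≤ weight x := by
    have hxz := norm_sub_norm_le x.1 z.1
    rw [weight, weight]
    nlinarith [norm_nonneg x.1, norm_nonneg z.1, mem_ball_zero_iff.1 x.2, mem_ball_zero_iff.1 z.2,
      norm_nonneg (x.1 - z.1)]
  have hratio : 0 ≤ 1 + -(1 / (6 * (k : ℝ))) := by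
    have : 1 / (6 * (k : ℝ)) ≤ 1 := by rw [div_le_one (by positivity)]; linarith
    linarith
  have hweight : weight z * (1 + -(1 / (6 * (k : ℝ)))) ≤ weight x :=
    calc _ = weight z - 2 * (weight z / (12 * k)) := by field_simp; ring
      _ ≤ weight x := by linarith
  have hbernoulli : 1 / 2 ≤ (1 + -(1 / (6 * (k : ℝ)))) ^ (3 * k) :=
    calc 1 / 2 = 1 + ((3 * k : ℕ) : ℝ) * -(1 / (6 * (k : ℝ))) := by push_cast; field_simp; ring
      _ ≤ _ := one_add_mul_le_pow (by linarith) (3 * k)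
  have hz := weight_pos z
  calc weight z ^ (3 * k) / 2 = weight z ^ (3 * k) * (1 / 2) := by ring
    _ ≤ weight z ^ (3 * k) * (1 + -(1 / (6 * (k : ℝ)))) ^ (3 * k) := by gcongr
    _ = (weight z * (1 + -(1 / (6 * (k : ℝ))))) ^ (3 * k) := (mul_pow _ _ _).symm
    _ ≤ weight x ^ (3 * k) := by gcongr

variable {Γ : Subgroup SU21} {k d : ℕ}

lemma norm_kodairaMap_le (hk : k ≠ 0) (ω : Fin d → H0 Γ k) {z x : Ball2} {V M : ℝ} (hV : 0 < V)
    (hx : ‖x.1 - z.1‖ ≤ weight z / (12 * k)) (hM : bergmanNorm ω x * V ≤ M)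
    (hlow : 1 / 2 ≤ bergmanNorm ω z * V) :
    ‖kodairaMap ω x.1‖ ≤ 2 * √M * ‖kodairaMap ω z.1‖ := by
  have hz := weight_pos z
  have hM0 : 0 ≤ M := by
    refine le_trans ?_ hM
    have := weight_pos x
    rw [bergmanNorm_eq]
    positivity
  rw [bergmanNorm_eq] at hM hlow
  have hcompare : weight z ^ (3 * k) * V * ‖kodairaMap ω x.1‖ ^ 2 ≤
      weight z ^ (3 * k) * V * (4 * M * ‖kodairaMap ω z.1‖ ^ 2) :=
    calc _ = 2 * (weight z ^ (3 * k) / 2 * ‖kodairaMap ω x.1‖ ^ 2 * V) := by ring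
      _ ≤ 2 * (weight x ^ (3 * k) * ‖kodairaMap ω x.1‖ ^ 2 * V) := by
        gcongr; exact half_pow_le_weight_pow hk hx
      _ ≤ 4 * M * (1 / 2) := by linarith
      _ ≤ 4 * M * (weight z ^ (3 * k) * ‖kodairaMap ω z.1‖ ^ 2 * V) := by gcongr
      _ = _ := by ring
  refine le_of_sq_le_sq ?_ (by positivity)
  rw [mul_pow, mul_pow, Real.sq_sqrt hM0]
  linarith [le_of_mul_le_mul_left hcompare (by positivity)]

variable [DiscreteTopology Γ] [CompactSpace (PicardSurface Γ)] {F : Set Ball2}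

-- The weight `(1 - |z|²)^{3k}` varies by a bounded factor on a ball of radius comparable to `1/k`,
-- and a Cauchy estimate on that ball costs one factor of `k` per derivative.
lemma exists_norm_fderiv_kodairaMap_le (hF : IsFundamentalDomain Γ F hypMeasure) (z : Ball2) :
    ∃ C : ℝ, ∀ k, 2 ≤ k → ∀ (d : ℕ) (ω : Fin d → H0 Γ k), IsOrthonormalBasis Γ F k ω →
      1 / 2 ≤ bergmanNorm ω z * weightIntegral k →
        ‖fderiv ℂ (kodairaMap ω) z.1‖ ≤ C * k * ‖kodairaMap ω z.1‖ := by
  have hz1 : ‖z.1‖ < 1 := mem_ball_zero_iff.1 z.2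
  obtain ⟨M, hM⟩ := exists_bergmanNorm_mul_weightIntegral_le (Γ := Γ) hF
    (r := (1 + ‖z.1‖) / 2) (by linarith)
  refine ⟨48 * √M / weight z, fun k hk d ω hω hlow => ?_⟩
  have hk2 : (2 : ℝ) ≤ k := by exact_mod_cast hk
  have hz := weight_pos z
  have hradius : weight z / (12 * k) ≤ (1 - ‖z.1‖) / 2 := by
    have hweight : weight z ≤ 2 * (1 - ‖z.1‖) := by
      rw [weight]
      nlinarith [norm_nonneg z.1]
    rw [div_le_iff₀ (by positivity)]
    nlinarith
  have hnorm {x : E} (hx : x ∈ Metric.ball z.1 (weight z / (12 * k))) :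
      ‖x‖ ≤ (1 + ‖z.1‖) / 2 := by
    linarith [norm_sub_norm_le x z.1, mem_ball_iff_norm.1 hx]
  have hball {x : E} (hx : x ∈ Metric.ball z.1 (weight z / (12 * k))) : x ∈ Metric.ball 0 1 :=
    mem_ball_zero_iff.2 (by linarith [hnorm hx])
  calc ‖fderiv ℂ (kodairaMap ω) z.1‖
      ≤ 2 * (2 * √M * ‖kodairaMap ω z.1‖) / (weight z / (12 * k)) :=
        norm_fderiv_le_of_forall_mem_ball (by positivity)
          ((differentiableOn_kodairaMap ω).mono fun x hx => hball hx) fun x hx =>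
            norm_kodairaMap_le (x := ⟨x, hball hx⟩) (by omega) ω (weightIntegral_pos (by omega))
              (mem_ball_iff_norm.1 hx).le (hM k hk d ω hω _ (hnorm hx)) hlow
    _ = 48 * √M / weight z * k * ‖kodairaMap ω z.1‖ := by field_simp; ring

theorem exists_norm_volRatio_le (hF : IsFundamentalDomain Γ F hypMeasure) (z : Ball2) :
    ∃ C : ℝ, ∀ k, 2 ≤ k → ∀ (d : ℕ) (ω : Fin d → H0 Γ k), IsOrthonormalBasis Γ F k ω →
      1 / 2 ≤ bergmanNorm ω z * weightIntegral k → ‖volRatio ω z‖ ≤ C * (k : ℝ) ^ 4 := by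
  obtain ⟨C, hC⟩ := exists_norm_fderiv_kodairaMap_le hF z
  obtain ⟨A, hA⟩ := (Set.finite_range fun i : Fin 2 × Fin 2 =>
    ‖dZ i.1 (dZbar i.2 logWeight) z.1‖).bddAbove
  refine ⟨192 * (3 * A + 2 * C ^ 2) ^ 2 / ‖hypVol z frame‖, fun k hk d ω hω hlow => ?_⟩
  have hk1 : (1 : ℝ) ≤ k := by exact_mod_cast (by omega : 1 ≤ k)
  have h0 : kodairaMap ω z.1 ≠ 0 := fun h => by norm_num [bergmanNorm_eq, h] at hlow
  have hT (j l : Fin 2) :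
      ‖dZ j (dZbar l (extendZero fun x => (Real.log (bergmanNorm ω x) : ℂ))) z.1‖ ≤
        (3 * A + 2 * C ^ 2) * k ^ 2 := by
    have hAjl : ‖dZ j (dZbar l logWeight) z.1‖ ≤ A := hA ⟨(j, l), rfl⟩
    have : 0 ≤ A := (norm_nonneg _).trans hAjl
    calc _ ≤ 3 * k * ‖dZ j (dZbar l logWeight) z.1‖ + 2 * (C * k) ^ 2 :=
          norm_dZ_dZbar_log_bergmanNorm_le ω h0 (hC k hk d ω hω hlow) j l
      _ ≤ 3 * k ^ 2 * A + 2 * (C * k) ^ 2 := by gcongr; nlinarith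
      _ = _ := by ring
  refine (norm_volRatio_le hT).trans_eq ?_
  ring

lemma tendsto_div_mul_log_of_le {a : ℕ → ℝ} (ha : ∀ k, 0 ≤ a k) {C : ℝ} {n : ℕ}
    (h : ∀ᶠ k : ℕ in atTop, a k ≤ C * (k : ℝ) ^ n) :
    Tendsto (fun k : ℕ => 1 / ((k : ℝ) ^ n * Real.log k) * a k) atTop (𝓝 0) := by
  have hlim : Tendsto (fun k : ℕ => C * (Real.log k)⁻¹) atTop (𝓝 0) := by
    simpa using ((Real.tendsto_log_atTop.comp
      tendsto_natCast_atTop_atTop).inv_tendsto_atTop).const_mul C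
  refine squeeze_zero' (.of_forall fun k => ?_) ?_ hlim
  · have := Real.log_natCast_nonneg k
    have := ha k
    positivity
  · filter_upwards [h, eventually_ge_atTop 2] with k hk hk2
    have hlog : 0 < Real.log k := Real.log_pos (by exact_mod_cast hk2)
    have : (0 : ℝ) < k := by positivity
    calc 1 / ((k : ℝ) ^ n * Real.log k) * a k
        ≤ 1 / ((k : ℝ) ^ n * Real.log k) * (C * (k : ℝ) ^ n) := by gcongr
      _ = C * (Real.log k)⁻¹ := by field_simp

end GradientBound

end Picard

end

theorem corollary11_general (Γ : Subgroup Picard.SU21) [DiscreteTopology Γ]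
    [CompactSpace (Picard.PicardSurface Γ)] {F : Set Picard.Ball2}
    (hF : IsFundamentalDomain Γ F Picard.hypMeasure) :
    (∀ k : ℕ, ∃ (d : ℕ) (ω : Fin d → Picard.H0 Γ k), Picard.IsOrthonormalBasis Γ F k ω) ∧
    ∀ (d : ℕ → ℕ) (ω : (k : ℕ) → Fin (d k) → Picard.H0 Γ k),
      (∀ k : ℕ, 1 ≤ k → Picard.IsOrthonormalBasis Γ F k (ω k)) →
      ∀ z : Picard.Ball2, (∀ γ ∈ Γ, γ • z = z → γ = 1) →
        (∀ᶠ k : ℕ in atTop, Picard.bergmanKernel (ω k) z z ≠ 0) ∧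
        Tendsto (fun k : ℕ => 1 / ((k : ℝ) ^ 4 * Real.log k) * ‖Picard.volRatio (ω k) z‖)
          atTop (𝓝 0) := by
  refine ⟨Picard.exists_isOrthonormalBasis hF, fun d ω hω z hz => ?_⟩
  have hlow : ∀ᶠ k in atTop, 1 / 2 ≤ Picard.bergmanNorm (ω k) z * Picard.weightIntegral k :=
    (Picard.tendsto_bergmanNorm_mul_weightIntegral hF hω hz).eventually_const_le (by norm_num)
  obtain ⟨C, hC⟩ := Picard.exists_norm_volRatio_le hF z
  refine ⟨hlow.mono fun k hk h => ?_,
    Picard.tendsto_div_mul_log_of_le (fun k => norm_nonneg _) (C := C) ?_⟩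
  · norm_num [Picard.bergmanNorm, h] at hk
  · filter_upwards [hlow, eventually_ge_atTop 2] with k hk hk2
    exact hC k hk2 _ _ (hω k (by omega)) hk

theorem corollary11 (Γ : Subgroup Picard.SU21)
    (hdiscrete : DiscreteTopology Γ)
    (htorsionfree : ∀ γ ∈ Γ, IsOfFinOrder γ → γ = 1)
    (hcocompact : CompactSpace (Picard.PicardSurface Γ))
    (F : Set Picard.Ball2)
    (hF : IsFundamentalDomain Γ F Picard.hypMeasure) :
    (∀ k : ℕ, 1 ≤ k → ∃ (d : ℕ) (ω : Fin d → Picard.H0 Γ k),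
      Picard.IsOrthonormalBasis Γ F k ω) ∧
    ∀ (d : ℕ → ℕ) (ω : (k : ℕ) → Fin (d k) → Picard.H0 Γ k),
      (∀ k : ℕ, 1 ≤ k → Picard.IsOrthonormalBasis Γ F k (ω k)) →
      ∀ z ∈ F,
        (∀ᶠ k : ℕ in atTop, Picard.bergmanKernel (ω k) z z ≠ 0) ∧
        ∃ L : ℝ, Tendsto
            (fun k : ℕ => 1 / ((k : ℝ) ^ 4 * Real.log k) * ‖Picard.volRatio (ω k) z‖)
            atTop (𝓝 L) ∧
          L ≤ 6048 := by
  obtain ⟨hbasis, hlim⟩ := corollary11_general Γ hF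
  refine ⟨fun k _ => hbasis k, fun d ω hω z _ => ?_⟩
  obtain ⟨hne, htendsto⟩ := hlim d ω hω z fun γ hγ hfix =>
    htorsionfree γ hγ (Picard.isOfFinOrder_of_smul_eq Γ hγ hfix)
  exact ⟨hne, 0, htendsto, by norm_num⟩
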